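/- For $s,a,c\in\mathbb{C}$ let $$\Omega=\{(s,a,c)\in\mathbb{C}^3: 0<\Re(s)<1,\ 0<\Re(a)<1,\ 0<\Re(c)<1\},\qquad \tilde\Omega=\{(s,a,c)\in\mathbb{C}^3: 0<\Re(a)<1,\ 0<\Re(c)<1\}.$$ On $\Omega$ the Lerch zeta function is given by the integral $$\zeta(s,a,c)=\frac{1}{\Gamma(s)}\int_0^\infty\frac{t^{s-1}e^{-ct}}{1-e^{2\pi i a}e^{-t}}\,dt .$$ Put $$L^{\pm}(s,a,c)=\zeta(s,a,c)\pm e^{-2\pi i a}\zeta(s,1-a,1-c),$$ $$\hat L^{+}(s,a,c)=\pi^{-s/2}\,\Gamma\!\left(\tfrac{s}{2}\right)L^{+}(s,a,c),\qquad \hat L^{-}(s,a,c)=\pi^{-(s+1)/2}\,\Gamma\!\left(\tfrac{s+1}{2}\right)L^{-}(s,a,c).$$ (1) The integral converges absolutely at every point of $\Omega$. The functions $\hat L^{+}$ and $\hat L^{-}$ are holomorphic in the three variables on $\Omega$, and for all $(s,a,c)\in\Omega$ $$\hat L^{+}(s,a,c)=e^{-2\pi i a c}\,\hat L^{+}(1-s,1-c,a),\qquad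 \hat L^{-}(s,a,c)=i\,e^{-2\pi i a c}\,\hat L^{-}(1-s,1-c,a).$$ (2) The function $\zeta$ continues to a holomorphic function of three variables on $\tilde\Omega$. This continuation equals the absolutely convergent series $\sum_{n\ge 0}e^{2\pi i n a}(n+c)^{-s}$ (principal branch of the powers) at all points of $\tilde\Omega$ with $\Im(a)>0$, and at those with $a$ real and $\Re(s)>1$. The functions $L^{+}$ and $L^{-}$ continue to holomorphic functions on $\tilde\Omega$, given by the same formulas in terms of the continued $\zeta$. The functions $\hat L^{+}$ and $\hat L^{-}$ also continue to holomorphic functions on $\tilde\Omega$; these continuations are given by the displayed formulas wherever the Gamma factor is finite (that is, for $s\notin\{0,-2,-4,\dots\}$ and for $s\notin\{-1,-3,-5,\dots\}$, respectively), and they satisfy the two functional equations in (1) at all points of $\tilde\Omega$. -/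

import Mathlib

open Complex

noncomputable section

/-- The fundamental polycylinder
`{(s, a, c) ∈ ℂ³ : 0 < Re s < 1, 0 < Re a < 1, 0 < Re c < 1}`. -/
def fundamentalPolycylinder : Set (ℂ × ℂ × ℂ) :=
  {p | (0 < p.1.re ∧ p.1.re < 1) ∧ (0 < p.2.1.re ∧ p.2.1.re < 1) ∧
    (0 < p.2.2.re ∧ p.2.2.re < 1)}

/-- The extended fundamental polycylinder
`{(s, a, c) ∈ ℂ³ : 0 < Re a < 1, 0 < Re c < 1}`, in which `s` is arbitrary. -/
def extendedPolycylinder : Set (ℂ × ℂ × ℂ) :=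
  {p | (0 < p.2.1.re ∧ p.2.1.re < 1) ∧ (0 < p.2.2.re ∧ p.2.2.re < 1)}

/-- The integrand `t^(s-1) e^(-ct) / (1 - e^(2πia) e^(-t))`. -/
def lerchIntegrand (s a c : ℂ) (t : ℝ) : ℂ :=
  (t : ℂ) ^ (s - 1) * exp (-c * t) / (1 - exp (2 * Real.pi * I * a) * exp (-(t : ℂ)))

/-- The Lerch zeta function, given on the fundamental polycylinder by its integral representation
`ζ(s,a,c) = Γ(s)⁻¹ ∫₀^∞ t^(s-1) e^(-ct) / (1 - e^(2πia) e^(-t)) dt`. -/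
def lerchZeta (s a c : ℂ) : ℂ :=
  1 / Gamma s * ∫ t in Set.Ioi (0 : ℝ), lerchIntegrand s a c t

/-- The `n`-th term `e^(2πina) (n + c)^(-s)` of the Lerch series. For `Re c > 0` the principal
branch of the power is the usual one. -/
def lerchTerm (s a c : ℂ) (n : ℕ) : ℂ :=
  exp (2 * Real.pi * I * n * a) * ((n : ℂ) + c) ^ (-s)

/-- `L⁺(s,a,c) = Z(s,a,c) + e^(-2πia) Z(s,1-a,1-c)`, for `Z` the Lerch zeta function or a
continuation of it. -/
def lerchLPlus (Z : ℂ → ℂ → ℂ → ℂ) (s a c : ℂ) : ℂ :=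
  Z s a c + exp (-2 * Real.pi * I * a) * Z s (1 - a) (1 - c)

/-- `L⁻(s,a,c) = Z(s,a,c) - e^(-2πia) Z(s,1-a,1-c)`. -/
def lerchLMinus (Z : ℂ → ℂ → ℂ → ℂ) (s a c : ℂ) : ℂ :=
  Z s a c - exp (-2 * Real.pi * I * a) * Z s (1 - a) (1 - c)

/-- `π^(-s/2) Γ(s/2) L⁺(s,a,c)`; meaningful where `s ∉ {0, -2, -4, …}`. -/
def lerchLHatPlus (Z : ℂ → ℂ → ℂ → ℂ) (s a c : ℂ) : ℂ :=
  (Real.pi : ℂ) ^ (-(s / 2)) * Gamma (s / 2) * lerchLPlus Z s a c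

/-- `π^(-(s+1)/2) Γ((s+1)/2) L⁻(s,a,c)`; meaningful where `s ∉ {-1, -3, -5, …}`. -/
def lerchLHatMinus (Z : ℂ → ℂ → ℂ → ℂ) (s a c : ℂ) : ℂ :=
  (Real.pi : ℂ) ^ (-((s + 1) / 2)) * Gamma ((s + 1) / 2) * lerchLMinus Z s a c

/-- `F(s,a,c)` is holomorphic, as a function of three complex variables jointly, on the
(open) set `U ⊆ ℂ³`. -/
def HolomorphicOn3 (F : ℂ → ℂ → ℂ → ℂ) (U : Set (ℂ × ℂ × ℂ)) : Prop :=
  DifferentiableOn ℂ (fun p : ℂ × ℂ × ℂ => F p.1 p.2.1 p.2.2) U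

/-- `F` is a holomorphic continuation to the extended polycylinder of the function `f`
given on the fundamental polycylinder. -/
def IsContinuationToExtended (f F : ℂ → ℂ → ℂ → ℂ) : Prop :=
  HolomorphicOn3 F extendedPolycylinder ∧
    ∀ s a c : ℂ, (s, a, c) ∈ fundamentalPolycylinder → F s a c = f s a c

end

section

open MeasureTheory Filter Topology Set Metric

/-! For real $a,c\in(0,1)$ and $\Re s>1$, expanding the integrand as a geometric series turns
$\zeta$ into the Lerch series and $L^{\pm}$ into sums over all $n\in\mathbb Z$ of $e^{2\pi i n
a}|n+c|^{-s}$, weighted by $\operatorname{sign}(n+c)$ in the minus case. The Gamma factors make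
these the Mellin transforms of `lerchEvenKernel` and `lerchOddKernel`. Jacobi inversion $t\mapsto
1/t$ sends $(a,c)$ to $(1-c,a)$; since neither $a$ nor $c$ is an integer, the theta series have no
constant terms, so the Mellin transforms are entire and satisfy the functional equations.

The integral is holomorphic in all three variables for $\Re s>0$. The identity theorem carries the
Mellin formula from $\Re s>1$ to $\Re s>0$, and then the functional equation on the strip from real
to complex $a,c$ (`functional_equation_of_ofReal`).

For the continuation, the functional equation defines $\hat L^{\pm}$ on $\Re s<1$, consistently on
the overlap (`reflectExtend`). Reflecting twice gives $(s,1-a,1-c)$, not $(s,a,c)$; the symmetry of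
$\hat L^{\pm}$ under this map makes the equation hold everywhere. Finally $\zeta=(L^++L^-)/2$, and
passing from $\hat L^{\pm}$ to $L^{\pm}$ creates no poles because reciprocal Gamma factors are
entire. -/

theorem aestronglyMeasurable_clm_of_apply {α E : Type*} [MeasurableSpace α] {μ : Measure α}
    [NormedAddCommGroup E] [NormedSpace ℂ E] [FiniteDimensional ℂ E] {φ : α → E →L[ℂ] ℂ}
    (h : ∀ v, AEStronglyMeasurable (fun t => φ t v) μ) : AEStronglyMeasurable φ μ := by
  let b := Module.finBasis ℂ E
  have key : φ = fun t => ∑ i, φ t (b i) • LinearMap.toContinuousLinearMap (b.coord i) := by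
    funext t
    ext v
    conv_lhs => rw [← b.sum_repr v]
    simp only [map_sum, map_smul, smul_eq_mul, sum_apply,
      smul_apply, LinearMap.coe_toContinuousLinearMap', Module.Basis.coord_apply]
    exact Finset.sum_congr rfl fun i _ => mul_comm _ _
  rw [key]
  exact Finset.aestronglyMeasurable_fun_sum _ fun i _ => (h (b i)).smul_const _

/-- A locally dominated integral of holomorphic functions is holomorphic. -/
theorem differentiableAt_integral_of_dominated_of_differentiableOn {α E : Type*}
    [MeasurableSpace α] {μ : Measure α}
    [NormedAddCommGroup E] [NormedSpace ℂ E] [FiniteDimensional ℂ E] {F : E → α → ℂ} {g : α → ℝ}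
    {x₀ : E} {r : ℝ} (hr : 0 < r) (hmeas : ∀ x ∈ ball x₀ r, AEStronglyMeasurable (F x) μ)
    (hd : ∀ᵐ t ∂μ, DifferentiableOn ℂ (F · t) (ball x₀ r))
    (hb : ∀ᵐ t ∂μ, ∀ x ∈ ball x₀ r, ‖F x t‖ ≤ g t) (hg : Integrable g μ) :
    DifferentiableAt ℂ (fun x => ∫ t, F x t ∂μ) x₀ := by
  have hx₀ : x₀ ∈ ball x₀ r := mem_ball_self hr
  have hderiv : ∀ᵐ t ∂μ, HasFDerivAt (F · t) (fderiv ℂ (F · t) x₀) x₀ := by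
    filter_upwards [hd] with t ht
    exact (ht.differentiableAt (ball_mem_nhds _ hr)).hasFDerivAt
  refine (hasFDerivAt_integral_of_dominated_loc_of_lip' (𝕜 := ℂ)
    -- The constant `2 * g t / r` is the Schwarz lemma bound: `F · t` maps the ball of radius `r`
    -- into the closed ball of radius `2 * g t` about `F x₀ t`.
    (F' := fun t => fderiv ℂ (F · t) x₀) (bound := fun t => 2 * g t / r)
    (ball_mem_nhds x₀ hr) hmeas ?_ ?_ ?_ ?_ hderiv).2.differentiableAt
  · exact hg.mono' (hmeas _ hx₀) (hb.mono fun t ht => ht _ hx₀)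
  · refine aestronglyMeasurable_clm_of_apply fun v => ?_
    -- The derivative in direction `v` is a pointwise limit of measurable difference quotients; the
    -- shift by `N` keeps the sample points inside the ball.
    have hlim : Tendsto (fun n : ℕ => x₀ + ((n : ℂ) + 1)⁻¹ • v) atTop (𝓝 x₀) := by
      have h1 : Tendsto (fun n : ℕ => ((n : ℂ) + 1)⁻¹) atTop (𝓝 0) := by
        simpa using tendsto_one_div_add_atTop_nhds_zero_nat (𝕜 := ℂ)
      simpa using (h1.smul_const v).const_add x₀
    obtain ⟨N, hN⟩ := eventually_atTop.1 (hlim.eventually (ball_mem_nhds x₀ hr))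
    refine aestronglyMeasurable_of_tendsto_ae atTop
      (f := fun (n : ℕ) t => (((n + N : ℕ) : ℂ) + 1) •
        (F (x₀ + (((n + N : ℕ) : ℂ) + 1)⁻¹ • v) t - F x₀ t)) (fun n => ?_) ?_
    · exact ((hmeas _ (hN _ (Nat.le_add_left _ _))).sub (hmeas _ hx₀)).const_smul (((n + N : ℕ) : ℂ) + 1)
    · filter_upwards [hderiv] with t ht
      have h2 := ht.lim v (c := fun n : ℕ => (n : ℂ) + 1) (l := atTop) (by
        have : Tendsto (fun n : ℕ => ((n : ℝ) + 1)) atTop atTop :=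
          tendsto_atTop_add_const_right _ _ tendsto_natCast_atTop_atTop
        refine this.congr fun n => ?_
        rw [← Nat.cast_succ, ← Nat.cast_succ, Complex.norm_natCast])
      exact (tendsto_add_atTop_iff_nat N).2 h2
  · filter_upwards [hd, hb] with t ht htb x hx
    have := dist_le_div_mul_dist_of_mapsTo_ball (R₂ := 2 * g t) ht (fun y hy => by
      rw [mem_closedBall, dist_eq_norm]
      linarith [norm_sub_le (F y t) (F x₀ t), htb y hy, htb x₀ hx₀]) hx
    rwa [dist_eq_norm, dist_eq_norm] at this
  · exact (hg.const_mul 2).div_const r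

/-! ### The Lerch integral and its holomorphy for $\Re s>0$ -/

/-- The part `0 < Re s` of the extended polycylinder. -/
def rightPolycylinder : Set (ℂ × ℂ × ℂ) := {p | 0 < p.1.re} ∩ extendedPolycylinder

theorem isOpen_extendedPolycylinder : IsOpen extendedPolycylinder := by
  unfold extendedPolycylinder
  refine ((isOpen_lt ?_ ?_).and (isOpen_lt ?_ ?_)).and
    ((isOpen_lt ?_ ?_).and (isOpen_lt ?_ ?_)) <;> fun_prop

theorem isOpen_rightPolycylinder : IsOpen rightPolycylinder :=
  (isOpen_lt (by fun_prop) (by fun_prop)).inter isOpen_extendedPolycylinder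

/-- If the difference vanished, comparing imaginary parts of logarithms would make `a.re` an
integer. The value `u = 0` is allowed so that $u=e^{-t}$ can range over a compact interval. -/
theorem exp_two_pi_I_mul_ne_real {a : ℂ} (ha : 0 < a.re) (ha' : a.re < 1) {u : ℝ} (hu : 0 ≤ u) :
    1 - exp (2 * Real.pi * I * a) * u ≠ 0 := by
  intro h
  have h1 : exp (2 * Real.pi * I * a) * u = 1 := (sub_eq_zero.1 h).symm
  have hu0 : 0 < u := hu.lt_of_ne (by rintro rfl; simp at h1)
  have h2 : exp (2 * Real.pi * I * a + Real.log u) = 1 := by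
    rw [exp_add, ← ofReal_exp, Real.exp_log hu0, h1]
  obtain ⟨n, hn⟩ := Complex.exp_eq_one_iff.1 h2
  have h3 := congrArg Complex.im hn
  simp at h3
  have h4 : a.re = n := by
    have := Real.pi_pos
    have h5 : (2 * Real.pi) * a.re = (2 * Real.pi) * n := by linarith
    exact mul_left_cancel₀ (by positivity) h5
  rw [h4] at ha ha'
  norm_cast at ha ha'
  omega

theorem lerchIntegrand_denom_ne_zero {a : ℂ} (ha : 0 < a.re) (ha' : a.re < 1) (t : ℝ) :
    1 - exp (2 * Real.pi * I * a) * exp (-(t : ℂ)) ≠ 0 := by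
  have := exp_two_pi_I_mul_ne_real ha ha' (Real.exp_pos (-t)).le
  push_cast at this
  exact this

theorem exists_lerchIntegrand_denom_bound {a₀ : ℂ} (ha : 0 < a₀.re) (ha' : a₀.re < 1) :
    ∃ r > 0, ∃ m > 0, ∀ a ∈ ball a₀ r, ∀ t : ℝ, 0 < t →
      m ≤ ‖1 - exp (2 * Real.pi * I * a) * exp (-(t : ℂ))‖ := by
  obtain ⟨r, hr, hsub⟩ := Metric.nhds_basis_closedBall.mem_iff.1
    (((isOpen_lt continuous_const Complex.continuous_re).inter
      (isOpen_lt Complex.continuous_re continuous_const)).mem_nhds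
      (show a₀ ∈ {z : ℂ | 0 < z.re} ∩ {z : ℂ | z.re < 1} from ⟨ha, ha'⟩))
  -- With $u=e^{-t}$, adding the endpoints $u=0$ and $u=1$ compactifies the range of `t`, so the
  -- norm attains a positive minimum.
  have hK : IsCompact (closedBall a₀ r ×ˢ Icc (0 : ℝ) 1) :=
    (isCompact_closedBall a₀ r).prod isCompact_Icc
  obtain ⟨q, hq, hmin⟩ := hK.exists_isMinOn
    ⟨(a₀, 0), mem_closedBall_self hr.le, by simp⟩
    (f := fun q : ℂ × ℝ => ‖1 - exp (2 * Real.pi * I * q.1) * (q.2 : ℂ)‖) (by fun_prop)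
  refine ⟨r, hr, _, norm_pos_iff.2 (exp_two_pi_I_mul_ne_real (hsub hq.1).1 (hsub hq.1).2 hq.2.1),
    fun a haa t ht => ?_⟩
  have := hmin (show (a, Real.exp (-t)) ∈ closedBall a₀ r ×ˢ Icc (0 : ℝ) 1 from
    ⟨ball_subset_closedBall haa, (Real.exp_pos _).le, Real.exp_le_one_iff.2 (by linarith)⟩)
  simpa using this

theorem exists_lerchIntegrand_bound {p₀ : ℂ × ℂ × ℂ} (hp : p₀ ∈ rightPolycylinder) :
    ∃ r > 0, ball p₀ r ⊆ rightPolycylinder ∧ ∃ g : ℝ → ℝ, IntegrableOn g (Ioi 0) ∧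
      ∀ p ∈ ball p₀ r, ∀ t : ℝ, 0 < t → ‖lerchIntegrand p.1 p.2.1 p.2.2 t‖ ≤ g t := by
  obtain ⟨r₁, hr₁, hsub⟩ := Metric.isOpen_iff.1 isOpen_rightPolycylinder p₀ hp
  obtain ⟨hs, ⟨ha, ha'⟩, hc, hc'⟩ := hp
  obtain ⟨r₂, hr₂, m, hm, hden⟩ := exists_lerchIntegrand_denom_bound ha ha'
  replace hs : 0 < p₀.1.re := hs
  set r := min (min r₁ r₂) (min (p₀.1.re / 2) (p₀.2.2.re / 2)) with hrdef
  have hr : 0 < r := by simp only [hrdef, lt_min_iff]; refine ⟨⟨hr₁, hr₂⟩, ?_, ?_⟩ <;> linarith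
  have hrr₁ : r ≤ r₁ := (min_le_left _ _).trans (min_le_left _ _)
  have hrr₂ : r ≤ r₂ := (min_le_left _ _).trans (min_le_right _ _)
  have hrs : r ≤ p₀.1.re / 2 := (min_le_right _ _).trans (min_le_left _ _)
  have hrc : r ≤ p₀.2.2.re / 2 := (min_le_right _ _).trans (min_le_right _ _)
  refine ⟨r, hr, (ball_subset_ball hrr₁).trans hsub,
    -- The two powers dominate $t^{\Re s-1}$ for $t\le 1$ and $t\ge 1$ respectively. Taking `r` at
    -- most half of each real part keeps the exponents above $-1$ and the decay rate positive.
    fun t => (t ^ (p₀.1.re - r - 1) * Real.exp (-(p₀.2.2.re - r) * t) +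
      t ^ (p₀.1.re + r - 1) * Real.exp (-(p₀.2.2.re - r) * t)) / m, ?_, ?_⟩
  · have h1 := integrableOn_rpow_mul_exp_neg_mul_rpow (s := p₀.1.re - r - 1) (p := 1)
      (b := p₀.2.2.re - r) (by linarith) one_pos (by linarith)
    have h2 := integrableOn_rpow_mul_exp_neg_mul_rpow (s := p₀.1.re + r - 1) (p := 1)
      (b := p₀.2.2.re - r) (by linarith) one_pos (by linarith)
    simp only [Real.rpow_one] at h1 h2
    exact (h1.add h2).div_const m
  · intro p hpb t ht
    rw [mem_ball, Prod.dist_eq, max_lt_iff, Prod.dist_eq, max_lt_iff] at hpb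
    obtain ⟨hps, hpa, hpc⟩ := hpb
    have hs1 := (abs_re_le_norm (p.1 - p₀.1)).trans_lt (by rwa [← dist_eq_norm])
    have hc1 := (abs_re_le_norm (p.2.2 - p₀.2.2)).trans_lt (by rwa [← dist_eq_norm])
    rw [sub_re, abs_lt] at hs1 hc1
    have hd := hden p.2.1 (mem_ball.2 (hpa.trans_le hrr₂)) t ht
    rw [lerchIntegrand, norm_div, norm_mul, norm_cpow_eq_rpow_re_of_pos ht, norm_exp, sub_re,
      one_re]
    beta_reduce
    rw [← add_mul]
    have he : (-p.2.2 * (t : ℂ)).re = - p.2.2.re * t := by simp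
    rw [he]
    have h3 : t ^ (p.1.re - 1) ≤ t ^ (p₀.1.re - r - 1) + t ^ (p₀.1.re + r - 1) := by
      have p1 := Real.rpow_pos_of_pos ht (p₀.1.re - r - 1)
      have p2 := Real.rpow_pos_of_pos ht (p₀.1.re + r - 1)
      rcases le_total t 1 with h | h
      · have := Real.rpow_le_rpow_of_exponent_ge ht h
          (show p₀.1.re - r - 1 ≤ p.1.re - 1 by linarith)
        linarith
      · have := Real.rpow_le_rpow_of_exponent_le h
          (show p.1.re - 1 ≤ p₀.1.re + r - 1 by linarith)
        linarith
    gcongr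
    linarith

theorem continuousOn_lerchIntegrand (s c : ℂ) {a : ℂ} (ha : 0 < a.re) (ha' : a.re < 1) :
    ContinuousOn (lerchIntegrand s a c) (Ioi 0) := by
  unfold lerchIntegrand
  refine ContinuousOn.div (ContinuousOn.mul (fun t ht => ?_) (by fun_prop)) (by fun_prop)
    fun t _ => lerchIntegrand_denom_ne_zero ha ha' t
  exact (continuousAt_ofReal_cpow_const _ _ (Or.inr (ne_of_gt ht))).continuousWithinAt

theorem integrableOn_lerchIntegrand {s a c : ℂ} (h : (s, a, c) ∈ rightPolycylinder) :
    IntegrableOn (lerchIntegrand s a c) (Ioi 0) := by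
  obtain ⟨r, hr, _, g, hg, hb⟩ := exists_lerchIntegrand_bound h
  exact hg.mono' ((continuousOn_lerchIntegrand s c h.2.1.1 h.2.1.2).aestronglyMeasurable
    measurableSet_Ioi) ((ae_restrict_iff' measurableSet_Ioi).2
      (ae_of_all _ fun t ht => hb _ (mem_ball_self hr) t ht))

theorem differentiableOn_lerchZeta : HolomorphicOn3 lerchZeta rightPolycylinder := by
  intro p₀ hp₀
  refine DifferentiableAt.differentiableWithinAt ?_
  obtain ⟨r, hr, hsub, g, hg, hb⟩ := exists_lerchIntegrand_bound hp₀
  unfold lerchZeta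
  have hG : Differentiable ℂ fun s : ℂ => 1 / Gamma s := by
    simpa only [one_div] using differentiable_one_div_Gamma
  refine (hG.comp differentiable_fst p₀).mul ?_
  refine differentiableAt_integral_of_dominated_of_differentiableOn hr (fun p hp => ?_) ?_ ?_ hg
  · exact (integrableOn_lerchIntegrand (hsub hp)).1
  · refine (ae_restrict_iff' measurableSet_Ioi).2 (ae_of_all _ fun t ht p hp => ?_)
    have ht' : (t : ℂ) ≠ 0 := ofReal_ne_zero.2 (ne_of_gt ht)
    have h1 : DifferentiableAt ℂ (fun p : ℂ × ℂ × ℂ => (t : ℂ) ^ (p.1 - 1) * exp (-p.2.2 * t)) p :=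
      (DifferentiableAt.const_cpow (by fun_prop) (Or.inl ht')).mul (by fun_prop)
    have h2 : DifferentiableAt ℂ (fun p : ℂ × ℂ × ℂ =>
        1 - exp (2 * Real.pi * I * p.2.1) * exp (-(t : ℂ))) p := by fun_prop
    simp only [lerchIntegrand, div_eq_mul_inv]
    exact (h1.mul (h2.inv (lerchIntegrand_denom_ne_zero (hsub hp).2.1.1
      (hsub hp).2.1.2 t))).differentiableWithinAt
  · exact (ae_restrict_iff' measurableSet_Ioi).2 (ae_of_all _ fun t ht p hp => hb p hp t ht)

/-! ### The Lerch series in the region of absolute convergence -/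

theorem eqOn_of_eventually_eq_ofReal {f g : ℂ → ℂ} {U : Set ℂ} (hU : IsOpen U)
    (hU' : IsPreconnected U) (hf : DifferentiableOn ℂ f U) (hg : DifferentiableOn ℂ g U) {x₀ : ℝ}
    (h₀ : (x₀ : ℂ) ∈ U) (h : ∀ᶠ x : ℝ in 𝓝 x₀, f x = g x) : EqOn f g U := by
  refine (hf.analyticOnNhd hU).eqOn_of_preconnected_of_frequently_eq (hg.analyticOnNhd hU) hU' h₀ ?_
  have hlim : Tendsto (fun x : ℝ => (x : ℂ)) (𝓝[≠] x₀) (𝓝[≠] (x₀ : ℂ)) :=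
    tendsto_nhdsWithin_iff.2 ⟨(continuous_ofReal.tendsto x₀).mono_left nhdsWithin_le_nhds,
      eventually_nhdsWithin_of_forall fun x hx => by simpa using hx⟩
  exact hlim.frequently (h.filter_mono nhdsWithin_le_nhds).frequently

theorem isOpen_re_pos : IsOpen {z : ℂ | 0 < z.re} := isOpen_lt continuous_const continuous_re

theorem isPreconnected_re_pos : IsPreconnected {z : ℂ | 0 < z.re} :=
  (convex_halfSpace_re_gt 0).isPreconnected

theorem norm_cpow_mul_exp_neg_mul {s r : ℂ} {t : ℝ} (ht : 0 < t) :
    ‖(t : ℂ) ^ (s - 1) * exp (-(r * t))‖ = t ^ (s.re - 1) * Real.exp (-(r.re * t)) := by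
  rw [norm_mul, norm_cpow_eq_rpow_re_of_pos ht, norm_exp]
  simp

theorem aestronglyMeasurable_cpow_mul_exp_neg_mul (s r : ℂ) :
    AEStronglyMeasurable (fun t : ℝ => (t : ℂ) ^ (s - 1) * exp (-(r * t)))
      (volume.restrict (Ioi 0)) := by
  refine ContinuousOn.aestronglyMeasurable (ContinuousOn.mul (fun t ht => ?_) (by fun_prop))
    measurableSet_Ioi
  exact (continuousAt_ofReal_cpow_const _ _ (Or.inr (ne_of_gt ht))).continuousWithinAt

theorem integrableOn_rpow_mul_exp_neg_mul {x b : ℝ} (hx : 0 < x) (hb : 0 < b) :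
    IntegrableOn (fun t : ℝ => t ^ (x - 1) * Real.exp (-(b * t))) (Ioi 0) := by
  have := integrableOn_rpow_mul_exp_neg_mul_rpow (s := x - 1) (by linarith) one_pos hb
  simpa only [Real.rpow_one, neg_mul] using this

theorem integrableOn_cpow_mul_exp_neg_mul {s r : ℂ} (hs : 0 < s.re) (hr : 0 < r.re) :
    IntegrableOn (fun t : ℝ => (t : ℂ) ^ (s - 1) * exp (-(r * t))) (Ioi 0) :=
  (integrableOn_rpow_mul_exp_neg_mul hs hr).mono' (aestronglyMeasurable_cpow_mul_exp_neg_mul s r)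
    ((ae_restrict_iff' measurableSet_Ioi).2 (ae_of_all _ fun _ ht =>
      (norm_cpow_mul_exp_neg_mul ht).le))

/-- The Gamma integral with a complex frequency. -/
theorem integral_cpow_mul_exp_neg_mul_Ioi_of_re_pos {s r : ℂ} (hs : 0 < s.re) (hr : 0 < r.re) :
    ∫ t in Ioi (0 : ℝ), (t : ℂ) ^ (s - 1) * exp (-(r * t)) = r ^ (-s) * Gamma s := by
  -- Both sides are holomorphic in `r` on the right half-plane, and the formula is known for
  -- positive real `r`.
  refine eqOn_of_eventually_eq_ofReal isOpen_re_pos isPreconnected_re_pos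
    (f := fun r : ℂ => ∫ t in Ioi (0 : ℝ), (t : ℂ) ^ (s - 1) * exp (-(r * t)))
    (g := fun r => r ^ (-s) * Gamma s) (fun z hz => ?_) (fun z hz => ?_) (x₀ := 1) (by simp) ?_ hr
  · replace hz : 0 < z.re := hz
    refine DifferentiableAt.differentiableWithinAt
      (differentiableAt_integral_of_dominated_of_differentiableOn (half_pos hz)
      (fun x _ => aestronglyMeasurable_cpow_mul_exp_neg_mul s x)
      (ae_of_all _ fun t => Differentiable.differentiableOn (by fun_prop))
      ((ae_restrict_iff' measurableSet_Ioi).2 (ae_of_all _ fun t ht x hx => ?_))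
      (integrableOn_rpow_mul_exp_neg_mul hs (half_pos hz)))
    replace ht : 0 < t := ht
    rw [norm_cpow_mul_exp_neg_mul ht]
    have h1 := (abs_re_le_norm (x - z)).trans_lt (by rwa [← dist_eq_norm])
    rw [sub_re, abs_lt] at h1
    gcongr
    linarith
  · exact ((differentiableAt_id.cpow_const (Or.inl hz)).mul_const
      _).differentiableWithinAt
  · filter_upwards [eventually_gt_nhds one_pos] with x hx
    rw [integral_cpow_mul_exp_neg_mul_Ioi hs hx, one_div, inv_cpow _ _ (by
      rw [arg_ofReal_of_nonneg hx.le]; exact Real.pi_pos.ne), cpow_neg]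

theorem norm_exp_two_pi_I_mul (a : ℂ) (n : ℕ) :
    ‖exp (2 * Real.pi * I * n * a)‖ = Real.exp (-(2 * Real.pi * a.im)) ^ n := by
  rw [norm_exp, ← Real.exp_nat_mul]
  congr 1
  simp
  ring

/-- The Lerch series converges to the Lerch integral in the region of absolute convergence. -/
theorem hasSum_lerchTerm_lerchZeta {s a c : ℂ} (h : (s, a, c) ∈ rightPolycylinder)
    (h' : 0 < a.im ∨ (a.im = 0 ∧ 1 < s.re)) : HasSum (lerchTerm s a c) (lerchZeta s a c) := by
  obtain ⟨hs, ⟨ha, ha'⟩, hc, hc'⟩ := h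
  replace hs : 0 < s.re := hs
  dsimp only at ha ha' hc hc'
  have him : 0 ≤ a.im := by rcases h' with h | h <;> linarith
  have hnc (n : ℕ) : 0 < ((n : ℂ) + c).re := by
    rw [add_re, natCast_re]; positivity
  let F (n : ℕ) (t : ℝ) : ℂ :=
    exp (2 * Real.pi * I * n * a) * ((t : ℂ) ^ (s - 1) * exp (-(((n : ℂ) + c) * t)))
  have hF_int (n : ℕ) : ∫ t in Ioi (0 : ℝ), F n t = lerchTerm s a c n * Gamma s := by
    rw [integral_const_mul, integral_cpow_mul_exp_neg_mul_Ioi_of_re_pos hs (hnc n), lerchTerm,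
      ← mul_assoc]
  have hF_norm (n : ℕ) : ∫ t in Ioi (0 : ℝ), ‖F n t‖ =
      Real.exp (-(2 * Real.pi * a.im)) ^ n * (1 / |(n : ℝ) + c.re| ^ s.re) * Real.Gamma s.re := by
    have hn : 0 < (n : ℝ) + c.re := by positivity
    rw [mul_assoc, abs_of_pos hn, ← Real.one_rpow s.re, ← Real.div_rpow zero_le_one hn.le,
      ← Real.integral_rpow_mul_exp_neg_mul_Ioi hs hn, ← integral_const_mul]
    refine setIntegral_congr_fun measurableSet_Ioi fun t ht => ?_
    simp only [F]
    rw [norm_mul, norm_exp_two_pi_I_mul, norm_cpow_mul_exp_neg_mul ht]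
    simp
  -- Sum and integral are interchanged. The integrated norms are dominated by a geometric series
  -- when $\Im a>0$, and form a shifted $p$-series when $\Im a=0$ and $\Re s>1$.
  have hsum := hasSum_integral_of_summable_integral_norm (μ := volume.restrict (Ioi (0 : ℝ)))
    (F := F) (fun n => (integrableOn_cpow_mul_exp_neg_mul hs (hnc n)).const_mul _) (by
      simp only [hF_norm]
      refine Summable.mul_right _ ?_
      rcases h' with h | ⟨h, h1⟩
      · refine Summable.of_nonneg_of_le (fun n => by positivity) (fun n => ?_)
          ((summable_geometric_of_lt_one (Real.exp_pos (-(2 * Real.pi * a.im))).le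
            (Real.exp_lt_one_iff.2 (neg_lt_zero.2 (by positivity)))).mul_right
            (1 / c.re ^ s.re))
        have hn : c.re ≤ |(n : ℝ) + c.re| := by
          rw [abs_of_pos (by positivity)]; simp
        gcongr
      · simpa [h] using (Real.summable_one_div_nat_add_rpow c.re s.re).2 h1)
  have htsum : ∫ t in Ioi (0 : ℝ), ∑' n, F n t = ∫ t in Ioi (0 : ℝ), lerchIntegrand s a c t := by
    refine setIntegral_congr_fun measurableSet_Ioi fun t ht => ?_
    have hlt : ‖exp (2 * Real.pi * I * a) * exp (-(t : ℂ))‖ < 1 := by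
      rw [← exp_add, norm_exp, Real.exp_lt_one_iff]
      have h1 : (2 * Real.pi * I * a + -(t : ℂ)).re = -(2 * Real.pi * a.im) - t := by
        simp
        ring
      rw [h1]
      have := Real.pi_pos
      have h2 : 0 ≤ 2 * Real.pi * a.im := by positivity
      linarith [show 0 < t from ht]
    have h1 (n : ℕ) : F n t = (t : ℂ) ^ (s - 1) * exp (-c * t) *
        (exp (2 * Real.pi * I * a) * exp (-(t : ℂ))) ^ n := by
      simp only [F]
      rw [← exp_add, ← exp_nat_mul, mul_left_comm, ← exp_add,
        mul_assoc ((t : ℂ) ^ (s - 1)), ← exp_add]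
      ring_nf
    simp only [h1]
    rw [tsum_mul_left, tsum_geometric_of_norm_lt_one hlt, lerchIntegrand, div_eq_mul_inv]
  rw [htsum] at hsum
  simp only [hF_int] at hsum
  have hG : Gamma s ≠ 0 := Gamma_ne_zero_of_re_pos hs
  convert! hsum.mul_left (1 / Gamma s) using 1
  funext n
  field_simp

/-! ### Theta kernels, their inversion and decay -/

/-- The theta series `∑ e^(2πina) e^(-π(n+c)²t)` over `n ∈ ℤ`. -/
noncomputable def lerchEvenKernel (a c t : ℝ) : ℂ :=
  exp (-Real.pi * c ^ 2 * t) * jacobiTheta₂ (a + I * c * t) (I * t)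

/-- The theta series `∑ e^(2πina) (n+c) e^(-π(n+c)²t)` over `n ∈ ℤ`. -/
noncomputable def lerchOddKernel (a c t : ℝ) : ℂ :=
  exp (-Real.pi * c ^ 2 * t) * (jacobiTheta₂' (a + I * c * t) (I * t) / (2 * Real.pi * I) +
    c * jacobiTheta₂ (a + I * c * t) (I * t))

theorem exp_mul_jacobiTheta₂_term (a c t : ℝ) (n : ℤ) :
    exp (-Real.pi * c ^ 2 * t) * jacobiTheta₂_term n (a + I * c * t) (I * t) =
      exp (2 * Real.pi * I * n * a) * Real.exp (-Real.pi * (n + c) ^ 2 * t) := by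
  rw [jacobiTheta₂_term, ← exp_add, ofReal_exp, ← exp_add]
  congr 1
  push_cast
  linear_combination (2 * Real.pi * n * c * t + Real.pi * n ^ 2 * t : ℂ) * I_sq

theorem hasSum_lerchEvenKernel (a c : ℝ) {t : ℝ} (ht : 0 < t) :
    HasSum (fun n : ℤ => exp (2 * Real.pi * I * n * a) * Real.exp (-Real.pi * (n + c) ^ 2 * t))
      (lerchEvenKernel a c t) := by
  simp only [← exp_mul_jacobiTheta₂_term]
  exact (hasSum_jacobiTheta₂_term _ (by simpa)).mul_left _

theorem hasSum_lerchOddKernel (a c : ℝ) {t : ℝ} (ht : 0 < t) :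
    HasSum (fun n : ℤ => exp (2 * Real.pi * I * n * a) * ((n + c : ℝ) : ℂ) *
      Real.exp (-Real.pi * (n + c) ^ 2 * t)) (lerchOddKernel a c t) := by
  have hτ : 0 < (I * (t : ℂ)).im := by simpa
  have h := (((hasSum_jacobiTheta₂'_term (a + I * c * t) hτ).div_const (2 * Real.pi * I)).add
    ((hasSum_jacobiTheta₂_term (a + I * c * t) hτ).mul_left (c : ℂ))).mul_left
    (exp (-Real.pi * c ^ 2 * t))
  refine h.congr_fun fun n => ?_
  have hpi : (Real.pi : ℂ) ≠ 0 := ofReal_ne_zero.2 Real.pi_ne_zero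
  rw [mul_right_comm, ← exp_mul_jacobiTheta₂_term, jacobiTheta₂'_term]
  push_cast
  field_simp [I_ne_zero]

theorem one_div_neg_I_mul_cpow_half {x : ℝ} (hx : 0 < x) :
    1 / (-I * (I * ((1 / x : ℝ) : ℂ))) ^ (1 / 2 : ℂ) = ((x ^ (1 / 2 : ℝ) : ℝ) : ℂ) := by
  have h1 : -I * (I * ((1 / x : ℝ) : ℂ)) = ((1 / x : ℝ) : ℂ) := by
    linear_combination -((1 / x : ℝ) : ℂ) * I_sq
  have h2 : (1 / 2 : ℂ) = ((1 / 2 : ℝ) : ℂ) := by push_cast; rfl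
  rw [h1, h2, ← ofReal_cpow (by positivity), Real.div_rpow zero_le_one hx.le, Real.one_rpow]
  push_cast
  rw [one_div_one_div]

theorem theta_arg_div {x : ℝ} (hx : 0 < x) (a c : ℝ) :
    ((a : ℂ) + I * c * ((1 / x : ℝ) : ℂ)) / (I * ((1 / x : ℝ) : ℂ)) =
      -(((1 - c : ℝ) : ℂ) + I * a * x) + 1 := by
  have hx' : (x : ℂ) ≠ 0 := ofReal_ne_zero.2 hx.ne'
  push_cast
  field_simp
  linear_combination (a * x : ℂ) * I_sq

theorem neg_one_div_I_mul_one_div {x : ℝ} (hx : 0 < x) :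
    -1 / (I * ((1 / x : ℝ) : ℂ)) = I * x := by
  have hx' : (x : ℂ) ≠ 0 := ofReal_ne_zero.2 hx.ne'
  push_cast
  field_simp
  linear_combination -I_sq

theorem theta_exp_factor {x : ℝ} (hx : 0 < x) (a c : ℝ) :
    exp (-Real.pi * c ^ 2 * ((1 / x : ℝ) : ℂ)) *
      exp (-Real.pi * I * ((a : ℂ) + I * c * ((1 / x : ℝ) : ℂ)) ^ 2 / (I * ((1 / x : ℝ) : ℂ))) =
      exp (-2 * Real.pi * I * a * c) * exp (-Real.pi * a ^ 2 * x) := by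
  have hx' : (x : ℂ) ≠ 0 := ofReal_ne_zero.2 hx.ne'
  rw [← exp_add, ← exp_add]
  congr 1
  push_cast
  field_simp
  linear_combination (-c ^ 2 : ℂ) * I_sq

/-- This is Jacobi's transformation at $\tau=i/x$. There $z/\tau=-(1-c+iax)+1$, so evenness and
1-periodicity of theta produce the parameters $(1-c,a)$. -/
theorem lerchEvenKernel_one_div (a c : ℝ) {x : ℝ} (hx : 0 < x) :
    lerchEvenKernel a c (1 / x) =
      exp (-2 * Real.pi * I * a * c) * ((x ^ (1 / 2 : ℝ) : ℝ) : ℂ) *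
        lerchEvenKernel (1 - c) a x := by
  rw [lerchEvenKernel, jacobiTheta₂_functional_equation, one_div_neg_I_mul_cpow_half hx,
    theta_arg_div hx, neg_one_div_I_mul_one_div hx, jacobiTheta₂_add_left, jacobiTheta₂_neg_left,
    lerchEvenKernel]
  linear_combination ((x ^ (1 / 2 : ℝ) : ℝ) : ℂ) *
    jacobiTheta₂ (((1 - c : ℝ) : ℂ) + I * a * x) (I * x) * theta_exp_factor hx a c

theorem lerchOddKernel_one_div (a c : ℝ) {x : ℝ} (hx : 0 < x) :
    lerchOddKernel a c (1 / x) =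
      I * exp (-2 * Real.pi * I * a * c) * ((x ^ (3 / 2 : ℝ) : ℝ) : ℂ) *
        lerchOddKernel (1 - c) a x := by
  have hx' : (x : ℂ) ≠ 0 := ofReal_ne_zero.2 hx.ne'
  have hpi : (Real.pi : ℂ) ≠ 0 := ofReal_ne_zero.2 Real.pi_ne_zero
  have hpow : ((x ^ (3 / 2 : ℝ) : ℝ) : ℂ) = x * ((x ^ (1 / 2 : ℝ) : ℝ) : ℂ) := by
    rw [show (3 / 2 : ℝ) = 1 + 1 / 2 by norm_num, Real.rpow_add hx, Real.rpow_one, ofReal_mul]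
  rw [lerchOddKernel, jacobiTheta₂_functional_equation (a + I * c * ((1 / x : ℝ) : ℂ)),
    jacobiTheta₂'_functional_equation,
    one_div_neg_I_mul_cpow_half hx, theta_arg_div hx, neg_one_div_I_mul_one_div hx,
    jacobiTheta₂_add_left, jacobiTheta₂_neg_left, jacobiTheta₂'_add_left, jacobiTheta₂'_neg_left,
    lerchOddKernel, hpow]
  have key := theta_exp_factor hx a c
  set E₁ := exp (-Real.pi * I * ((a : ℂ) + I * c * ((1 / x : ℝ) : ℂ)) ^ 2 / (I * ((1 / x : ℝ) : ℂ)))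
  set T := jacobiTheta₂ (((1 - c : ℝ) : ℂ) + I * a * x) (I * x)
  set T' := jacobiTheta₂' (((1 - c : ℝ) : ℂ) + I * a * x) (I * x)
  set R := ((x ^ (1 / 2 : ℝ) : ℝ) : ℂ)
  -- Differentiating the transformation law produces an extra multiple of `T`; together with the
  -- `c`-term of the kernel it leaves exactly the term `a * T` needed on the right.
  have hinner : R * E₁ / (I * ((1 / x : ℝ) : ℂ)) *
      (-T' - 2 * Real.pi * I * (a + I * c * ((1 / x : ℝ) : ℂ)) * T) / (2 * Real.pi * I) +
      c * (R * E₁ * T) = E₁ * (R * I * x * (T' / (2 * Real.pi * I) + a * T)) := by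
    push_cast
    field_simp
    ring_nf
    simp only [show I ^ 3 = -I by rw [pow_succ, I_sq]; ring, I_sq]
    ring
  rw [hinner]
  linear_combination R * I * x * (T' / (2 * Real.pi * I) + a * T) * key

theorem continuousOn_lerchEvenKernel (a c : ℝ) : ContinuousOn (lerchEvenKernel a c) (Ioi 0) := by
  intro t ht
  refine ContinuousAt.continuousWithinAt (ContinuousAt.mul (by fun_prop) ?_)
  exact (continuousAt_jacobiTheta₂ (a + I * c * t) (by simpa using ht)).comp
    (f := fun u : ℝ => ((a + I * c * u : ℂ), I * (u : ℂ))) (by fun_prop)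

theorem continuousOn_lerchOddKernel (a c : ℝ) : ContinuousOn (lerchOddKernel a c) (Ioi 0) := by
  intro t ht
  have h1 := (continuousAt_jacobiTheta₂ (a + I * c * t) (by simpa using ht)).comp
    (f := fun u : ℝ => ((a + I * c * u : ℂ), I * (u : ℂ))) (by fun_prop)
  have h2 := (continuousAt_jacobiTheta₂' (a + I * c * t) (by simpa using ht)).comp
    (f := fun u : ℝ => ((a + I * c * u : ℂ), I * (u : ℂ))) (by fun_prop)
  exact ContinuousAt.continuousWithinAt (ContinuousAt.mul (by fun_prop)
    ((h2.div_const _).add (continuousAt_const.mul h1)))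

theorem norm_exp_two_pi_I_int_mul (a : ℝ) (n : ℤ) : ‖exp (2 * Real.pi * I * n * a)‖ = 1 := by
  rw [norm_exp]
  simp

theorem norm_lerchEvenKernel_le (a c : ℝ) {t : ℝ} (ht : 0 < t) :
    ‖lerchEvenKernel a c t‖ ≤ HurwitzZeta.evenKernel c t := by
  refine (hasSum_lerchEvenKernel a c ht).norm_le_of_bounded
    (HurwitzZeta.hasSum_int_evenKernel c ht) fun n => ?_
  rw [norm_mul, norm_exp_two_pi_I_int_mul, one_mul, norm_real, Real.norm_eq_abs, Real.abs_exp]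

theorem norm_lerchOddKernel_le (a c : ℝ) {t : ℝ} (ht : 1 ≤ t) :
    ‖lerchOddKernel a c t‖ ≤ HurwitzZeta.evenKernel c (t / 2) := by
  refine (hasSum_lerchOddKernel a c (by linarith)).norm_le_of_bounded
    (HurwitzZeta.hasSum_int_evenKernel c (by linarith)) fun n => ?_
  rw [norm_mul, norm_mul, norm_exp_two_pi_I_int_mul, one_mul, norm_real, norm_real,
    Real.norm_eq_abs, Real.norm_eq_abs, Real.abs_exp]
  set y : ℝ := n + c
  -- Half of the Gaussian absorbs the linear factor, which is why the majorant is evaluated at `t /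
  -- 2`.
  have h1 : |y| ≤ Real.exp (Real.pi * y ^ 2 * (t / 2)) := by
    have h2 : y ^ 2 ≤ Real.pi * y ^ 2 * (t / 2) := by
      have := mul_le_mul_of_nonneg_left (show 2 ≤ Real.pi * t by
        nlinarith [Real.pi_gt_three]) (sq_nonneg y)
      linarith
    have h3 := Real.add_one_le_exp (Real.pi * y ^ 2 * (t / 2))
    have h4 : |y| ≤ y ^ 2 + 1 := by
      rw [← sq_abs]
      nlinarith [sq_nonneg (|y| - 1), abs_nonneg y]
    linarith
  calc |y| * Real.exp (-Real.pi * y ^ 2 * t)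
      ≤ Real.exp (Real.pi * y ^ 2 * (t / 2)) * Real.exp (-Real.pi * y ^ 2 * t) := by gcongr
    _ = Real.exp (-Real.pi * y ^ 2 * (t / 2)) := by rw [← Real.exp_add]; congr 1; ring

/-- The limit at infinity is the contribution of $n+c=0$, absent because `c` is not an integer. -/
theorem exists_isBigO_evenKernel {c : ℝ} (hc : c ∈ Ioo (0 : ℝ) 1) : ∃ p : ℝ, 0 < p ∧
    HurwitzZeta.evenKernel c =O[atTop] fun t => Real.exp (-p * t) := by
  obtain ⟨p, hp, h⟩ := HurwitzZeta.isBigO_atTop_evenKernel_sub c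
  have hc0 : (c : UnitAddCircle) ≠ 0 := by
    rw [Ne, AddCircle.coe_eq_zero_iff]
    rintro ⟨n, hn⟩
    rw [zsmul_one] at hn
    obtain ⟨h1, h2⟩ := hc
    rw [← hn] at h1 h2
    norm_cast at h1 h2
    omega
  exact ⟨p, hp, by simpa [hc0] using h⟩

theorem isBigO_lerchEvenKernel (a : ℝ) {c : ℝ} (hc : c ∈ Ioo (0 : ℝ) 1) (r : ℝ) :
    lerchEvenKernel a c =O[atTop] fun t : ℝ => t ^ r := by
  obtain ⟨p, hp, h⟩ := exists_isBigO_evenKernel hc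
  refine (Asymptotics.IsBigO.of_bound 1 ?_).trans
    (h.trans (isLittleO_exp_neg_mul_rpow_atTop hp r).isBigO)
  filter_upwards [eventually_gt_atTop 0] with t ht
  rw [one_mul]
  exact (norm_lerchEvenKernel_le a c ht).trans (le_abs_self _)

theorem isBigO_lerchOddKernel (a : ℝ) {c : ℝ} (hc : c ∈ Ioo (0 : ℝ) 1) (r : ℝ) :
    lerchOddKernel a c =O[atTop] fun t : ℝ => t ^ r := by
  obtain ⟨p, hp, h⟩ := exists_isBigO_evenKernel hc
  have h2 : (fun t : ℝ => HurwitzZeta.evenKernel c (t / 2)) =O[atTop]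
      fun t => Real.exp (-(p / 2) * t) := by
    refine (h.comp_tendsto (tendsto_id.atTop_div_const two_pos)).congr_right fun t => ?_
    simp only [Function.comp_apply, id_eq]
    ring_nf
  refine (Asymptotics.IsBigO.of_bound 1 ?_).trans
    (h2.trans (isLittleO_exp_neg_mul_rpow_atTop (half_pos hp) r).isBigO)
  filter_upwards [eventually_ge_atTop 1] with t ht
  rw [one_mul]
  exact (norm_lerchOddKernel_le a c ht).trans (le_abs_self _)

/-! ### Mellin transforms and their functional equations -/

/-- The even Lerch theta series as a functional-equation pair. -/
noncomputable def lerchEvenFEPair {a c : ℝ} (ha : a ∈ Ioo (0 : ℝ) 1) (hc : c ∈ Ioo (0 : ℝ) 1) :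
    WeakFEPair ℂ where
  f := lerchEvenKernel a c
  g := lerchEvenKernel (1 - c) a
  k := 1 / 2
  ε := exp (-2 * Real.pi * I * a * c)
  -- Zero constant terms on both sides make the pair strong, so its Mellin transform is entire.
  f₀ := 0
  g₀ := 0
  hf_int := (continuousOn_lerchEvenKernel _ _).locallyIntegrableOn measurableSet_Ioi
  hg_int := (continuousOn_lerchEvenKernel _ _).locallyIntegrableOn measurableSet_Ioi
  hk := one_half_pos
  hε := exp_ne_zero _
  h_feq x hx := lerchEvenKernel_one_div a c hx
  hf_top r := by simpa using isBigO_lerchEvenKernel a hc r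
  hg_top r := by simpa using isBigO_lerchEvenKernel (1 - c) ha r

/-- The odd Lerch theta series as a functional-equation pair. -/
noncomputable def lerchOddFEPair {a c : ℝ} (ha : a ∈ Ioo (0 : ℝ) 1) (hc : c ∈ Ioo (0 : ℝ) 1) :
    WeakFEPair ℂ where
  f := lerchOddKernel a c
  g := lerchOddKernel (1 - c) a
  k := 3 / 2
  ε := I * exp (-2 * Real.pi * I * a * c)
  f₀ := 0
  g₀ := 0
  hf_int := (continuousOn_lerchOddKernel _ _).locallyIntegrableOn measurableSet_Ioi
  hg_int := (continuousOn_lerchOddKernel _ _).locallyIntegrableOn measurableSet_Ioi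
  hk := by norm_num
  hε := mul_ne_zero I_ne_zero (exp_ne_zero _)
  h_feq x hx := lerchOddKernel_one_div a c hx
  hf_top r := by simpa using isBigO_lerchOddKernel a hc r
  hg_top r := by simpa using isBigO_lerchOddKernel (1 - c) ha r

theorem isStrongFEPair_lerchEvenFEPair {a c : ℝ} (ha : a ∈ Ioo (0 : ℝ) 1)
    (hc : c ∈ Ioo (0 : ℝ) 1) : IsStrongFEPair (lerchEvenFEPair ha hc) := ⟨rfl, rfl⟩

theorem isStrongFEPair_lerchOddFEPair {a c : ℝ} (ha : a ∈ Ioo (0 : ℝ) 1)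
    (hc : c ∈ Ioo (0 : ℝ) 1) : IsStrongFEPair (lerchOddFEPair ha hc) := ⟨rfl, rfl⟩

theorem differentiable_mellin_lerchEvenKernel {a c : ℝ} (ha : a ∈ Ioo (0 : ℝ) 1)
    (hc : c ∈ Ioo (0 : ℝ) 1) : Differentiable ℂ (mellin (lerchEvenKernel a c)) := by
  have h := isStrongFEPair_lerchEvenFEPair ha hc
  have := h.differentiable_Λ
  rwa [h.Λ_eq] at this

theorem differentiable_mellin_lerchOddKernel {a c : ℝ} (ha : a ∈ Ioo (0 : ℝ) 1)
    (hc : c ∈ Ioo (0 : ℝ) 1) : Differentiable ℂ (mellin (lerchOddKernel a c)) := by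
  have h := isStrongFEPair_lerchOddFEPair ha hc
  have := h.differentiable_Λ
  rwa [h.Λ_eq] at this

theorem mellin_lerchEvenKernel_sub {a c : ℝ} (ha : a ∈ Ioo (0 : ℝ) 1)
    (hc : c ∈ Ioo (0 : ℝ) 1) (s : ℂ) : mellin (lerchEvenKernel a c) (1 / 2 - s) =
      exp (-2 * Real.pi * I * a * c) * mellin (lerchEvenKernel (1 - c) a) s := by
  have h := isStrongFEPair_lerchEvenFEPair ha hc
  have h1 := (lerchEvenFEPair ha hc).functional_equation s
  rw [h.Λ_eq, h.symm_Λ_eq] at h1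
  simpa [lerchEvenFEPair] using h1

theorem mellin_lerchOddKernel_sub {a c : ℝ} (ha : a ∈ Ioo (0 : ℝ) 1)
    (hc : c ∈ Ioo (0 : ℝ) 1) (s : ℂ) : mellin (lerchOddKernel a c) (3 / 2 - s) =
      I * exp (-2 * Real.pi * I * a * c) * mellin (lerchOddKernel (1 - c) a) s := by
  have h := isStrongFEPair_lerchOddFEPair ha hc
  have h1 := (lerchOddFEPair ha hc).functional_equation s
  rw [h.Λ_eq, h.symm_Λ_eq] at h1
  simpa [lerchOddFEPair] using h1

/-! ### Holomorphy of $L^{\pm}$ and $\hat L^{\pm}$ for $\Re s>0$ -/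

theorem mem_rightPolycylinder_one_sub {s a c : ℂ} (h : (s, a, c) ∈ rightPolycylinder) :
    (s, 1 - a, 1 - c) ∈ rightPolycylinder := by
  obtain ⟨hs, ⟨ha, ha'⟩, hc, hc'⟩ := h
  dsimp only at ha ha' hc hc'
  refine ⟨hs, ⟨?_, ?_⟩, ?_, ?_⟩ <;> simp <;> linarith

theorem differentiableOn_lerchZeta_one_sub :
    HolomorphicOn3 (fun s a c => lerchZeta s (1 - a) (1 - c)) rightPolycylinder :=
  differentiableOn_lerchZeta.comp (f := fun p : ℂ × ℂ × ℂ => (p.1, 1 - p.2.1, 1 - p.2.2))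
    (by fun_prop) fun _ hp => mem_rightPolycylinder_one_sub hp

theorem differentiableOn_lerchLPlus : HolomorphicOn3 (lerchLPlus lerchZeta) rightPolycylinder :=
  differentiableOn_lerchZeta.add
    (DifferentiableOn.mul (by fun_prop) differentiableOn_lerchZeta_one_sub)

theorem differentiableOn_lerchLMinus : HolomorphicOn3 (lerchLMinus lerchZeta) rightPolycylinder :=
  differentiableOn_lerchZeta.sub
    (DifferentiableOn.mul (by fun_prop) differentiableOn_lerchZeta_one_sub)

theorem lerchLHatPlus_eq_Gammaℝ_mul (Z : ℂ → ℂ → ℂ → ℂ) (s a c : ℂ) :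
    lerchLHatPlus Z s a c = Gammaℝ s * lerchLPlus Z s a c := by
  rw [lerchLHatPlus, Gammaℝ_def, neg_div]

theorem lerchLHatMinus_eq_Gammaℝ_mul (Z : ℂ → ℂ → ℂ → ℂ) (s a c : ℂ) :
    lerchLHatMinus Z s a c = Gammaℝ (s + 1) * lerchLMinus Z s a c := by
  rw [lerchLHatMinus, Gammaℝ_def, neg_div]

theorem differentiableAt_Gammaℝ {s : ℂ} (hs : 0 < s.re) : DifferentiableAt ℂ Gammaℝ s := by
  have h := (differentiable_Gammaℝ_inv s).inv (inv_ne_zero (Gammaℝ_ne_zero_of_re_pos hs))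
  convert! h using 1
  funext z
  simp

theorem differentiableOn_lerchLHatPlus :
    HolomorphicOn3 (lerchLHatPlus lerchZeta) rightPolycylinder := by
  unfold HolomorphicOn3
  simp only [lerchLHatPlus_eq_Gammaℝ_mul]
  exact DifferentiableOn.mul (fun p hp => ((differentiableAt_Gammaℝ hp.1).comp p
    differentiableAt_fst).differentiableWithinAt) differentiableOn_lerchLPlus

theorem differentiableOn_lerchLHatMinus :
    HolomorphicOn3 (lerchLHatMinus lerchZeta) rightPolycylinder := by
  unfold HolomorphicOn3
  simp only [lerchLHatMinus_eq_Gammaℝ_mul]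
  refine DifferentiableOn.mul (fun p hp => ?_) differentiableOn_lerchLMinus
  have hp1 : 0 < (p.1 + 1).re := by
    rw [add_re, one_re]; linarith [show 0 < p.1.re from hp.1]
  exact ((differentiableAt_Gammaℝ hp1).comp p
    (f := fun q : ℂ × ℂ × ℂ => q.1 + 1) (by fun_prop)).differentiableWithinAt

/-! ### Real parameters: completed functions as Mellin transforms -/

section RealParameters

variable {a c : ℝ}

theorem ofReal_mem_rightPolycylinder (ha : a ∈ Ioo (0 : ℝ) 1) (hc : c ∈ Ioo (0 : ℝ) 1) {s : ℂ}
    (hs : 0 < s.re) : (s, (a : ℂ), (c : ℂ)) ∈ rightPolycylinder :=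
  ⟨hs, ha, hc⟩

theorem lerchTerm_eq_div (hc : c ∈ Ioo (0 : ℝ) 1) (s : ℂ) (n : ℕ) :
    lerchTerm s a c n = exp (2 * Real.pi * I * ((n : ℤ) : ℂ) * a) /
      ((|((n : ℤ) : ℝ) + c| : ℝ) : ℂ) ^ s := by
  have h : 0 < ((n : ℤ) : ℝ) + c := by
    rw [Int.cast_natCast]; have := hc.1; positivity
  rw [abs_of_pos h, lerchTerm, cpow_neg, div_eq_mul_inv]
  push_cast
  rfl

/-- The reflected series supplies the negative indices $-(n+1)$ of the two-sided sum:
$|-(n+1)+c|=n+1-c$, and the phases agree up to $e^{2\pi i n}=1$. -/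
theorem exp_mul_lerchTerm_eq_div (hc : c ∈ Ioo (0 : ℝ) 1) (s : ℂ) (n : ℕ) :
    exp (-2 * Real.pi * I * a) * lerchTerm s (1 - a) (1 - c) n =
      exp (2 * Real.pi * I * ((-((n : ℤ) + 1) : ℤ) : ℂ) * a) /
        ((|((-((n : ℤ) + 1) : ℤ) : ℝ) + c| : ℝ) : ℂ) ^ s := by
  have h : |((-((n : ℤ) + 1) : ℤ) : ℝ) + c| = n + (1 - c) := by
    rw [abs_of_neg]
    · push_cast; ring
    · push_cast
      linarith [hc.2, (Nat.cast_nonneg n : (0 : ℝ) ≤ n)]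
  rw [h, lerchTerm, cpow_neg, div_eq_mul_inv, ← mul_assoc, ← exp_add]
  congr 1
  · have h1 : -2 * Real.pi * I * a + 2 * Real.pi * I * n * (1 - a) =
        2 * Real.pi * I * ((-((n : ℤ) + 1) : ℤ) : ℂ) * a + n * (2 * Real.pi * I) := by
      push_cast; ring
    rw [h1, exp_add, exp_nat_mul_two_pi_mul_I, mul_one]
  · push_cast
    rfl

theorem hasSum_lerchTerm_ofReal (ha : a ∈ Ioo (0 : ℝ) 1) (hc : c ∈ Ioo (0 : ℝ) 1) {s : ℂ}
    (hs : 1 < s.re) : HasSum (lerchTerm s a c) (lerchZeta s a c) ∧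
      HasSum (lerchTerm s (1 - a) (1 - c)) (lerchZeta s (1 - a) (1 - c)) := by
  have h := ofReal_mem_rightPolycylinder ha hc (s := s) (by linarith)
  exact ⟨hasSum_lerchTerm_lerchZeta h (Or.inr (by simpa using hs)),
    hasSum_lerchTerm_lerchZeta (mem_rightPolycylinder_one_sub h) (Or.inr (by simpa using hs))⟩

theorem hasSum_int_lerchLPlus (ha : a ∈ Ioo (0 : ℝ) 1) (hc : c ∈ Ioo (0 : ℝ) 1) {s : ℂ}
    (hs : 1 < s.re) : HasSum (fun n : ℤ => exp (2 * Real.pi * I * n * a) /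
      ((|(n : ℝ) + c| : ℝ) : ℂ) ^ s) (lerchLPlus lerchZeta s a c) := by
  obtain ⟨h1, h2⟩ := hasSum_lerchTerm_ofReal ha hc hs
  refine HasSum.of_nat_of_neg_add_one ?_ ?_
  · exact h1.congr_fun fun n => (lerchTerm_eq_div hc s n).symm
  · exact (h2.mul_left _).congr_fun fun n => (exp_mul_lerchTerm_eq_div hc s n).symm

theorem hasSum_int_lerchLMinus (ha : a ∈ Ioo (0 : ℝ) 1) (hc : c ∈ Ioo (0 : ℝ) 1) {s : ℂ}
    (hs : 1 < s.re) : HasSum (fun n : ℤ => exp (2 * Real.pi * I * n * a) *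
      SignType.sign ((n : ℝ) + c) / ((|(n : ℝ) + c| : ℝ) : ℂ) ^ s)
      (lerchLMinus lerchZeta s a c) := by
  obtain ⟨h1, h2⟩ := hasSum_lerchTerm_ofReal ha hc hs
  rw [lerchLMinus, sub_eq_add_neg]
  refine HasSum.of_nat_of_neg_add_one ?_ ?_
  · refine h1.congr_fun fun n => ?_
    have hpos : 0 < ((n : ℤ) : ℝ) + c := by
      rw [Int.cast_natCast]; have := hc.1; positivity
    rw [sign_pos hpos, lerchTerm_eq_div hc]
    simp
  · refine (h2.mul_left _).neg.congr_fun fun n => ?_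
    have hneg : ((-((n : ℤ) + 1) : ℤ) : ℝ) + c < 0 := by
      push_cast
      linarith [hc.2, (Nat.cast_nonneg n : (0 : ℝ) ≤ n)]
    rw [sign_neg hneg, exp_mul_lerchTerm_eq_div hc]
    simp only [SignType.coe_neg_one]
    ring

theorem int_cast_add_ne_zero (hc : c ∈ Ioo (0 : ℝ) 1) (n : ℤ) : (n : ℝ) + c ≠ 0 := by
  intro h
  obtain ⟨h1, h2⟩ := hc
  rw [eq_neg_of_add_eq_zero_right h, ← Int.cast_neg] at h1 h2
  norm_cast at h1 h2
  omega

theorem summable_norm_exp_div (a c : ℝ) {x : ℝ} (hx : 1 < x) :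
    Summable fun n : ℤ => ‖exp (2 * Real.pi * I * n * a)‖ / |(n : ℝ) + c| ^ x := by
  simp only [norm_exp_two_pi_I_int_mul]
  exact (Real.summable_one_div_int_add_rpow c x).2 hx

theorem lerchLHatPlus_eq_mellin_of_one_lt_re (ha : a ∈ Ioo (0 : ℝ) 1) (hc : c ∈ Ioo (0 : ℝ) 1)
    {s : ℂ} (hs : 1 < s.re) :
    lerchLHatPlus lerchZeta s a c = mellin (lerchEvenKernel a c) (s / 2) := by
  have h1 := hasSum_mellin_pi_mul_sq (a := fun n : ℤ => exp (2 * Real.pi * I * n * a))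
    (r := fun n : ℤ => (n : ℝ) + c) (F := lerchEvenKernel a c) (s := s) (by linarith)
    (fun t ht => by
      simpa only [if_neg (int_cast_add_ne_zero hc _)] using hasSum_lerchEvenKernel a c ht)
    (summable_norm_exp_div a c hs)
  rw [lerchLHatPlus_eq_Gammaℝ_mul]
  refine HasSum.unique ?_ h1
  simpa only [mul_div_assoc] using (hasSum_int_lerchLPlus ha hc hs).mul_left (Gammaℝ s)

theorem lerchLHatMinus_eq_mellin_of_one_lt_re (ha : a ∈ Ioo (0 : ℝ) 1) (hc : c ∈ Ioo (0 : ℝ) 1)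
    {s : ℂ} (hs : 1 < s.re) :
    lerchLHatMinus lerchZeta s a c = mellin (lerchOddKernel a c) ((s + 1) / 2) := by
  have h1 := hasSum_mellin_pi_mul_sq' (a := fun n : ℤ => exp (2 * Real.pi * I * n * a))
    (r := fun n : ℤ => (n : ℝ) + c) (F := lerchOddKernel a c) (s := s) (by linarith)
    (fun t ht => hasSum_lerchOddKernel a c ht) (summable_norm_exp_div a c hs)
  rw [lerchLHatMinus_eq_Gammaℝ_mul]
  refine HasSum.unique ?_ h1
  simpa only [mul_div_assoc, mul_assoc] using
    (hasSum_int_lerchLMinus ha hc hs).mul_left (Gammaℝ (s + 1))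

theorem eventually_one_lt_re_ofReal : ∀ᶠ x : ℝ in 𝓝 2, 1 < (x : ℂ).re := by
  simpa using eventually_gt_nhds (one_lt_two : (1 : ℝ) < 2)

/-- The Mellin side is entire in `s`, so the identity for $\Re s>1$ propagates to $\Re s>0$,
covering the critical strip. -/
theorem lerchLHatPlus_eq_mellin (ha : a ∈ Ioo (0 : ℝ) 1) (hc : c ∈ Ioo (0 : ℝ) 1)
    {s : ℂ} (hs : 0 < s.re) :
    lerchLHatPlus lerchZeta s a c = mellin (lerchEvenKernel a c) (s / 2) := by
  refine eqOn_of_eventually_eq_ofReal isOpen_re_pos isPreconnected_re_pos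
    (f := fun s => lerchLHatPlus lerchZeta s a c)
    (g := fun s => mellin (lerchEvenKernel a c) (s / 2)) ?_ ?_ (x₀ := 2) (by simp)
    (eventually_one_lt_re_ofReal.mono fun x hx => lerchLHatPlus_eq_mellin_of_one_lt_re ha hc hx) hs
  · exact differentiableOn_lerchLHatPlus.comp (f := fun s : ℂ => (s, (a : ℂ), (c : ℂ)))
      (by fun_prop) fun s hs => ofReal_mem_rightPolycylinder ha hc hs
  · exact ((differentiable_mellin_lerchEvenKernel ha hc).comp
      (differentiable_id.div_const 2)).differentiableOn

theorem lerchLHatMinus_eq_mellin (ha : a ∈ Ioo (0 : ℝ) 1) (hc : c ∈ Ioo (0 : ℝ) 1)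
    {s : ℂ} (hs : 0 < s.re) :
    lerchLHatMinus lerchZeta s a c = mellin (lerchOddKernel a c) ((s + 1) / 2) := by
  refine eqOn_of_eventually_eq_ofReal isOpen_re_pos isPreconnected_re_pos
    (f := fun s => lerchLHatMinus lerchZeta s a c)
    (g := fun s => mellin (lerchOddKernel a c) ((s + 1) / 2)) ?_ ?_ (x₀ := 2) (by simp)
    (eventually_one_lt_re_ofReal.mono fun x hx => lerchLHatMinus_eq_mellin_of_one_lt_re ha hc hx) hs
  · exact differentiableOn_lerchLHatMinus.comp (f := fun s : ℂ => (s, (a : ℂ), (c : ℂ)))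
      (by fun_prop) fun s hs => ofReal_mem_rightPolycylinder ha hc hs
  · exact ((differentiable_mellin_lerchOddKernel ha hc).comp
      ((differentiable_id.add_const 1).div_const 2)).differentiableOn

theorem lerchLHatPlus_one_sub_ofReal (ha : a ∈ Ioo (0 : ℝ) 1) (hc : c ∈ Ioo (0 : ℝ) 1)
    {s : ℂ} (hs : 0 < s.re) (hs' : s.re < 1) :
    lerchLHatPlus lerchZeta s a c =
      exp (-2 * Real.pi * I * a * c) * lerchLHatPlus lerchZeta (1 - s) (1 - c) a := by
  have hc1 : 1 - c ∈ Ioo (0 : ℝ) 1 := ⟨by linarith [hc.2], by linarith [hc.1]⟩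
  have h := mellin_lerchEvenKernel_sub ha hc ((1 - s) / 2)
  have h1 : (1 : ℂ) - c = ((1 - c : ℝ) : ℂ) := by push_cast; rfl
  rw [lerchLHatPlus_eq_mellin ha hc hs, h1,
    lerchLHatPlus_eq_mellin hc1 ha (by simpa), ← h]
  ring_nf

theorem lerchLHatMinus_one_sub_ofReal (ha : a ∈ Ioo (0 : ℝ) 1) (hc : c ∈ Ioo (0 : ℝ) 1)
    {s : ℂ} (hs : 0 < s.re) (hs' : s.re < 1) :
    lerchLHatMinus lerchZeta s a c =
      I * exp (-2 * Real.pi * I * a * c) * lerchLHatMinus lerchZeta (1 - s) (1 - c) a := by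
  have hc1 : 1 - c ∈ Ioo (0 : ℝ) 1 := ⟨by linarith [hc.2], by linarith [hc.1]⟩
  have h := mellin_lerchOddKernel_sub ha hc ((1 - s + 1) / 2)
  have h1 : (1 : ℂ) - c = ((1 - c : ℝ) : ℂ) := by push_cast; rfl
  rw [lerchLHatMinus_eq_mellin ha hc hs, h1,
    lerchLHatMinus_eq_mellin hc1 ha (by simpa), ← h]
  ring_nf

end RealParameters

/-! ### From real to complex parameters -/

theorem isOpen_re_mem_Ioo : IsOpen {z : ℂ | 0 < z.re ∧ z.re < 1} :=
  (isOpen_lt continuous_const continuous_re).inter (isOpen_lt continuous_re continuous_const)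

theorem isPreconnected_re_mem_Ioo : IsPreconnected {z : ℂ | 0 < z.re ∧ z.re < 1} :=
  ((convex_halfSpace_re_gt 0).inter (convex_halfSpace_re_lt 1)).isPreconnected

/-- Two separately holomorphic functions on a product of strips that agree at real points agree. -/
theorem eq_of_eq_on_ofReal {f g : ℂ → ℂ → ℂ}
    (hf₁ : ∀ c : ℂ, 0 < c.re ∧ c.re < 1 →
      DifferentiableOn ℂ (fun a => f a c) {z | 0 < z.re ∧ z.re < 1})
    (hf₂ : ∀ a : ℂ, 0 < a.re ∧ a.re < 1 → DifferentiableOn ℂ (f a) {z | 0 < z.re ∧ z.re < 1})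
    (hg₁ : ∀ c : ℂ, 0 < c.re ∧ c.re < 1 →
      DifferentiableOn ℂ (fun a => g a c) {z | 0 < z.re ∧ z.re < 1})
    (hg₂ : ∀ a : ℂ, 0 < a.re ∧ a.re < 1 → DifferentiableOn ℂ (g a) {z | 0 < z.re ∧ z.re < 1})
    (h : ∀ a ∈ Ioo (0 : ℝ) 1, ∀ c ∈ Ioo (0 : ℝ) 1, f a c = g a c) {a c : ℂ}
    (ha : 0 < a.re ∧ a.re < 1) (hc : 0 < c.re ∧ c.re < 1) : f a c = g a c := by
  have hmem : ((1 / 2 : ℝ) : ℂ) ∈ {z : ℂ | 0 < z.re ∧ z.re < 1} := by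
    constructor <;> rw [ofReal_re] <;> norm_num
  have hev : ∀ᶠ x : ℝ in 𝓝 (1 / 2), x ∈ Ioo (0 : ℝ) 1 :=
    Ioo_mem_nhds (by norm_num) (by norm_num)
  -- The identity theorem is applied in `a` with `c` still real, then in `c` with `a` already
  -- complex.
  have h1 (c : ℝ) (hc : c ∈ Ioo (0 : ℝ) 1) : f a c = g a c :=
    eqOn_of_eventually_eq_ofReal isOpen_re_mem_Ioo isPreconnected_re_mem_Ioo (hf₁ c hc) (hg₁ c hc)
      hmem (hev.mono fun x hx => h x hx c hc) ha
  exact eqOn_of_eventually_eq_ofReal isOpen_re_mem_Ioo isPreconnected_re_mem_Ioo (hf₂ a ha)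
    (hg₂ a ha) hmem (hev.mono fun x hx => h1 x hx) hc

theorem fundamentalPolycylinder_subset : fundamentalPolycylinder ⊆ rightPolycylinder :=
  fun _ hp => ⟨hp.1.1, hp.2⟩

theorem mem_rightPolycylinder_reflect {s a c : ℂ} (h : (s, a, c) ∈ extendedPolycylinder)
    (hs : s.re < 1) : (1 - s, 1 - c, a) ∈ rightPolycylinder := by
  obtain ⟨⟨ha, ha'⟩, hc, hc'⟩ := h
  dsimp only at ha ha' hc hc'
  refine ⟨?_, ⟨?_, ?_⟩, ?_, ?_⟩ <;> simp <;> linarith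

/-- The functional equation `G(s,a,c) = η e^(-2πiac) G(1-s,1-c,a)` extends from real `a, c`. -/
theorem functional_equation_of_ofReal {G : ℂ → ℂ → ℂ → ℂ} {η : ℂ}
    (hG : HolomorphicOn3 G rightPolycylinder) {s : ℂ} (hs : 0 < s.re) (hs' : s.re < 1)
    (h : ∀ a ∈ Ioo (0 : ℝ) 1, ∀ c ∈ Ioo (0 : ℝ) 1,
      G s a c = η * exp (-2 * Real.pi * I * a * c) * G (1 - s) (1 - c) a) {a c : ℂ}
    (ha : 0 < a.re ∧ a.re < 1) (hc : 0 < c.re ∧ c.re < 1) :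
    G s a c = η * exp (-2 * Real.pi * I * a * c) * G (1 - s) (1 - c) a := by
  refine eq_of_eq_on_ofReal (f := G s)
    (g := fun a c => η * exp (-2 * Real.pi * I * a * c) * G (1 - s) (1 - c) a)
    (fun c hc => ?_) (fun a ha => ?_) (fun c hc => ?_) (fun a ha => ?_) h ha hc
  · exact hG.comp (f := fun a : ℂ => (s, a, c)) (by fun_prop) fun a ha => ⟨hs, ha, hc⟩
  · exact hG.comp (f := fun c : ℂ => (s, a, c)) (by fun_prop) fun c hc => ⟨hs, ha, hc⟩
  · exact DifferentiableOn.mul (by fun_prop) (hG.comp (f := fun a : ℂ => (1 - s, 1 - c, a))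
      (by fun_prop) fun a ha => mem_rightPolycylinder_reflect ⟨ha, hc⟩ hs')
  · exact DifferentiableOn.mul (by fun_prop) (hG.comp (f := fun c : ℂ => (1 - s, 1 - c, a))
      (by fun_prop) fun c hc => mem_rightPolycylinder_reflect ⟨ha, hc⟩ hs')

/-- The factor `1` is kept so that the statement fits the general root number `η`. -/
theorem lerchLHatPlus_functional_equation {s a c : ℂ} (h : (s, a, c) ∈ fundamentalPolycylinder) :
    lerchLHatPlus lerchZeta s a c =
      1 * exp (-2 * Real.pi * I * a * c) * lerchLHatPlus lerchZeta (1 - s) (1 - c) a :=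
  functional_equation_of_ofReal differentiableOn_lerchLHatPlus h.1.1 h.1.2
    (fun a ha c hc => by
      rw [one_mul]; exact lerchLHatPlus_one_sub_ofReal ha hc h.1.1 h.1.2) h.2.1 h.2.2

theorem lerchLHatMinus_functional_equation {s a c : ℂ} (h : (s, a, c) ∈ fundamentalPolycylinder) :
    lerchLHatMinus lerchZeta s a c =
      I * exp (-2 * Real.pi * I * a * c) * lerchLHatMinus lerchZeta (1 - s) (1 - c) a :=
  functional_equation_of_ofReal differentiableOn_lerchLHatMinus h.1.1 h.1.2
    (fun _ ha _ hc => lerchLHatMinus_one_sub_ofReal ha hc h.1.1 h.1.2) h.2.1 h.2.2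

/-! ### Continuation in $s$ by reflection -/

/-- Extension of `G` from `0 < Re s` to all `s` by the functional equation
`G(s,a,c) = η e^(-2πiac) G(1-s,1-c,a)`. -/
noncomputable def reflectExtend (η : ℂ) (G : ℂ → ℂ → ℂ → ℂ) (s a c : ℂ) : ℂ :=
  if 0 < s.re then G s a c else η * exp (-2 * Real.pi * I * a * c) * G (1 - s) (1 - c) a

section ReflectExtend

variable {η : ℂ} {G : ℂ → ℂ → ℂ → ℂ}

theorem reflectExtend_of_pos {s : ℂ} (hs : 0 < s.re) (a c : ℂ) :
    reflectExtend η G s a c = G s a c := if_pos hs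

/-- On the strip $0<\Re s<1$ the functional equation reconciles the two branches. Hence each formula
holds on an open set, and the two sets cover the extended polycylinder. -/
theorem reflectExtend_of_lt_one
    (hfe : ∀ s a c : ℂ, (s, a, c) ∈ fundamentalPolycylinder →
      G s a c = η * exp (-2 * Real.pi * I * a * c) * G (1 - s) (1 - c) a)
    {s a c : ℂ} (h : (s, a, c) ∈ extendedPolycylinder) (hs : s.re < 1) :
    reflectExtend η G s a c = η * exp (-2 * Real.pi * I * a * c) * G (1 - s) (1 - c) a := by
  by_cases h0 : 0 < s.re
  · rw [reflectExtend_of_pos h0, hfe s a c ⟨⟨h0, hs⟩, h⟩]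
  · rw [reflectExtend, if_neg h0]

theorem differentiableOn_reflectExtend (hG : HolomorphicOn3 G rightPolycylinder)
    (hfe : ∀ s a c : ℂ, (s, a, c) ∈ fundamentalPolycylinder →
      G s a c = η * exp (-2 * Real.pi * I * a * c) * G (1 - s) (1 - c) a) :
    HolomorphicOn3 (reflectExtend η G) extendedPolycylinder := by
  intro p hp
  refine DifferentiableAt.differentiableWithinAt ?_
  by_cases h0 : 0 < p.1.re
  · refine (hG.differentiableAt (isOpen_rightPolycylinder.mem_nhds ⟨h0, hp⟩)).congr_of_eventuallyEq
      ?_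
    filter_upwards [isOpen_rightPolycylinder.mem_nhds (⟨h0, hp⟩ : p ∈ rightPolycylinder)] with q hq
    exact reflectExtend_of_pos hq.1 _ _
  · have h1 : p.1.re < 1 := by linarith
    have hO : IsOpen (extendedPolycylinder ∩ {q : ℂ × ℂ × ℂ | q.1.re < 1}) :=
      isOpen_extendedPolycylinder.inter (isOpen_lt (by fun_prop) (by fun_prop))
    have hd : DifferentiableAt ℂ (fun q : ℂ × ℂ × ℂ =>
        η * exp (-2 * Real.pi * I * q.2.1 * q.2.2) * G (1 - q.1) (1 - q.2.2) q.2.1) p := by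
      refine DifferentiableAt.mul (by fun_prop) ?_
      exact (hG.differentiableAt (isOpen_rightPolycylinder.mem_nhds
        (mem_rightPolycylinder_reflect hp h1))).comp p
        (f := fun q : ℂ × ℂ × ℂ => (1 - q.1, 1 - q.2.2, q.2.1)) (by fun_prop)
    refine hd.congr_of_eventuallyEq ?_
    filter_upwards [hO.mem_nhds ⟨hp, h1⟩] with q hq
    exact reflectExtend_of_lt_one hfe hq.1 hq.2

theorem reflectExtend_one_sub
    (hsym : ∀ s a c : ℂ, G s (1 - a) (1 - c) = η ^ 2 * exp (2 * Real.pi * I * a) * G s a c)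
    (s a c : ℂ) : reflectExtend η G s (1 - a) (1 - c) =
      η ^ 2 * exp (2 * Real.pi * I * a) * reflectExtend η G s a c := by
  by_cases h0 : 0 < s.re
  · rw [reflectExtend_of_pos h0, reflectExtend_of_pos h0, hsym]
  · rw [reflectExtend, if_neg h0, reflectExtend, if_neg h0, hsym]
    have he : exp (-2 * Real.pi * I * (1 - a) * (1 - c)) * exp (2 * Real.pi * I * (1 - c)) =
        exp (2 * Real.pi * I * a) * exp (-2 * Real.pi * I * a * c) := by
      rw [← exp_add, ← exp_add]
      ring_nf
    linear_combination η ^ 3 * G (1 - s) (1 - c) a * he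

/-- For $\Re s\ge 1$ the equation reflects twice and lands on `G s (1 - a) (1 - c)`. The symmetry
`hsym` returns to `G s a c`; the exponentials cancel and the roots multiply to `η ^ 4`. -/
theorem reflectExtend_functional_equation (hη : η ^ 4 = 1)
    (hfe : ∀ s a c : ℂ, (s, a, c) ∈ fundamentalPolycylinder →
      G s a c = η * exp (-2 * Real.pi * I * a * c) * G (1 - s) (1 - c) a)
    (hsym : ∀ s a c : ℂ, G s (1 - a) (1 - c) = η ^ 2 * exp (2 * Real.pi * I * a) * G s a c)
    {s a c : ℂ} (h : (s, a, c) ∈ extendedPolycylinder) : reflectExtend η G s a c =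
      η * exp (-2 * Real.pi * I * a * c) * reflectExtend η G (1 - s) (1 - c) a := by
  rcases lt_or_ge s.re 1 with h1 | h1
  · rw [reflectExtend_of_lt_one hfe h h1, reflectExtend_of_pos (by simpa using h1)]
  · rw [reflectExtend_of_pos (by linarith), reflectExtend, if_neg (by simpa using h1),
      sub_sub_cancel, hsym]
    have he : exp (-2 * Real.pi * I * a * c) * exp (-2 * Real.pi * I * (1 - c) * a) *
        exp (2 * Real.pi * I * a) = 1 := by
      rw [← exp_add, ← exp_add]
      convert exp_zero using 2
      ring
    linear_combination -G s a c * hη - η ^ 4 * G s a c * he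

end ReflectExtend

section Symmetry

variable (Z : ℂ → ℂ → ℂ → ℂ) (s a c : ℂ)

theorem exp_neg_mul_exp_two_pi_I_mul :
    exp (-2 * Real.pi * I * a) * exp (2 * Real.pi * I * a) = 1 := by
  rw [← exp_add, ← exp_zero]
  ring_nf

theorem exp_neg_two_pi_I_mul_one_sub :
    exp (-2 * Real.pi * I * (1 - a)) = exp (2 * Real.pi * I * a) := by
  rw [show -2 * Real.pi * I * (1 - a) = 2 * Real.pi * I * a - 2 * Real.pi * I by ring,
    exp_periodic.sub_eq]

theorem lerchLHatPlus_one_sub : lerchLHatPlus Z s (1 - a) (1 - c) =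
    1 ^ 2 * exp (2 * Real.pi * I * a) * lerchLHatPlus Z s a c := by
  rw [lerchLHatPlus, lerchLHatPlus, lerchLPlus, lerchLPlus, exp_neg_two_pi_I_mul_one_sub,
    sub_sub_cancel, sub_sub_cancel]
  linear_combination -(Real.pi : ℂ) ^ (-(s / 2)) * Gamma (s / 2) * Z s (1 - a) (1 - c) *
    exp_neg_mul_exp_two_pi_I_mul a

/-- The sign of the swap is written `I ^ 2` to match `η ^ 2` in `reflectExtend_one_sub`. -/
theorem lerchLHatMinus_one_sub : lerchLHatMinus Z s (1 - a) (1 - c) =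
    I ^ 2 * exp (2 * Real.pi * I * a) * lerchLHatMinus Z s a c := by
  rw [lerchLHatMinus, lerchLHatMinus, lerchLMinus, lerchLMinus, exp_neg_two_pi_I_mul_one_sub,
    sub_sub_cancel, sub_sub_cancel, I_sq]
  linear_combination -(Real.pi : ℂ) ^ (-((s + 1) / 2)) * Gamma ((s + 1) / 2) *
    Z s (1 - a) (1 - c) * exp_neg_mul_exp_two_pi_I_mul a

end Symmetry

/-! ### The continued functions -/

/-- The continuation of the completed function `L̂⁺`. -/
noncomputable def lerchHPlus : ℂ → ℂ → ℂ → ℂ := reflectExtend 1 (lerchLHatPlus lerchZeta)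

/-- The continuation of the completed function `L̂⁻`. -/
noncomputable def lerchHMinus : ℂ → ℂ → ℂ → ℂ := reflectExtend I (lerchLHatMinus lerchZeta)

/-- The continuation of the Lerch zeta function. -/
noncomputable def lerchZetaExt (s a c : ℂ) : ℂ :=
  ((Gammaℝ s)⁻¹ * lerchHPlus s a c + (Gammaℝ (s + 1))⁻¹ * lerchHMinus s a c) / 2

theorem differentiableOn_lerchHPlus : HolomorphicOn3 lerchHPlus extendedPolycylinder :=
  differentiableOn_reflectExtend differentiableOn_lerchLHatPlus
    fun _ _ _ => lerchLHatPlus_functional_equation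

theorem differentiableOn_lerchHMinus : HolomorphicOn3 lerchHMinus extendedPolycylinder :=
  differentiableOn_reflectExtend differentiableOn_lerchLHatMinus
    fun _ _ _ => lerchLHatMinus_functional_equation

theorem differentiableOn_inv_Gammaℝ_mul_lerchHPlus :
    HolomorphicOn3 (fun s a c => (Gammaℝ s)⁻¹ * lerchHPlus s a c) extendedPolycylinder :=
  DifferentiableOn.mul ((differentiable_Gammaℝ_inv.comp
    (f := fun p : ℂ × ℂ × ℂ => p.1) (by fun_prop)).differentiableOn) differentiableOn_lerchHPlus

theorem differentiableOn_inv_Gammaℝ_mul_lerchHMinus :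
    HolomorphicOn3 (fun s a c => (Gammaℝ (s + 1))⁻¹ * lerchHMinus s a c) extendedPolycylinder :=
  DifferentiableOn.mul ((differentiable_Gammaℝ_inv.comp
    (f := fun p : ℂ × ℂ × ℂ => p.1 + 1) (by fun_prop)).differentiableOn)
    differentiableOn_lerchHMinus

theorem differentiableOn_lerchZetaExt : HolomorphicOn3 lerchZetaExt extendedPolycylinder := by
  unfold HolomorphicOn3
  simp only [lerchZetaExt, div_eq_mul_inv]
  exact (differentiableOn_inv_Gammaℝ_mul_lerchHPlus.add
    differentiableOn_inv_Gammaℝ_mul_lerchHMinus).mul_const _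

theorem lerchZetaExt_one_sub (s a c : ℂ) : lerchZetaExt s (1 - a) (1 - c) =
    exp (2 * Real.pi * I * a) *
      ((Gammaℝ s)⁻¹ * lerchHPlus s a c - (Gammaℝ (s + 1))⁻¹ * lerchHMinus s a c) / 2 := by
  rw [lerchZetaExt, lerchHPlus, lerchHMinus, reflectExtend_one_sub (lerchLHatPlus_one_sub _),
    reflectExtend_one_sub (lerchLHatMinus_one_sub _), I_sq]
  ring

/-- Under $(a,c)\mapsto(1-a,1-c)$ the two halves of `lerchZetaExt` acquire the same exponential and
opposite signs, so the combination isolates one half, even at poles of the Gamma factors. -/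
theorem lerchLPlus_lerchZetaExt (s a c : ℂ) :
    lerchLPlus lerchZetaExt s a c = (Gammaℝ s)⁻¹ * lerchHPlus s a c := by
  rw [lerchLPlus, lerchZetaExt_one_sub, lerchZetaExt]
  linear_combination ((Gammaℝ s)⁻¹ * lerchHPlus s a c - (Gammaℝ (s + 1))⁻¹ * lerchHMinus s a c) /
    2 * exp_neg_mul_exp_two_pi_I_mul a

theorem lerchLMinus_lerchZetaExt (s a c : ℂ) :
    lerchLMinus lerchZetaExt s a c = (Gammaℝ (s + 1))⁻¹ * lerchHMinus s a c := by
  rw [lerchLMinus, lerchZetaExt_one_sub, lerchZetaExt]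
  linear_combination -((Gammaℝ s)⁻¹ * lerchHPlus s a c - (Gammaℝ (s + 1))⁻¹ * lerchHMinus s a c) /
    2 * exp_neg_mul_exp_two_pi_I_mul a

theorem lerchZetaExt_eq_lerchZeta {s : ℂ} (hs : 0 < s.re) (a c : ℂ) :
    lerchZetaExt s a c = lerchZeta s a c := by
  have h1 : Gammaℝ s ≠ 0 := Gammaℝ_ne_zero_of_re_pos hs
  have h2 : Gammaℝ (s + 1) ≠ 0 :=
    Gammaℝ_ne_zero_of_re_pos (by rw [add_re, one_re]; linarith)
  rw [lerchZetaExt, lerchHPlus, lerchHMinus, reflectExtend_of_pos hs, reflectExtend_of_pos hs,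
    lerchLHatPlus_eq_Gammaℝ_mul, lerchLHatMinus_eq_Gammaℝ_mul, inv_mul_cancel_left₀ h1,
    inv_mul_cancel_left₀ h2, lerchLPlus, lerchLMinus]
  ring

/-! ### The Lerch series for arbitrary $s$ when $\Im a>0$ -/

theorem norm_cpow_neg_le {z s : ℂ} {k : ℕ} (hz : 1 ≤ ‖z‖) (hs : ‖s‖ ≤ k) :
    ‖z ^ (-s)‖ ≤ ‖z‖ ^ k * Real.exp (Real.pi * k) := by
  refine (norm_cpow_le z (-s)).trans ?_
  rw [div_eq_mul_inv, ← Real.exp_neg, ← Real.rpow_natCast]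
  gcongr
  · exact ((le_abs_self _).trans (abs_re_le_norm _)).trans (by rwa [norm_neg])
  · refine (neg_le_abs _).trans ?_
    rw [abs_mul]
    exact mul_le_mul (abs_arg_le_pi z) ((abs_im_le_norm _).trans (by rwa [norm_neg]))
      (abs_nonneg _) Real.pi_pos.le

/-- Geometric decay $|e^{2\pi i a}|^n$ beats the polynomial growth of the powers, uniformly for
bounded `s`. The index starts at `n + 1` so that the base has norm at least 1. -/
theorem exists_summable_bound_lerchTerm {a c : ℂ} (ha : 0 < a.im) (hc : 0 < c.re) (k : ℕ) :
    ∃ u : ℕ → ℝ, Summable u ∧ ∀ n, ∀ s ∈ ball (0 : ℂ) k, ‖lerchTerm s a c (n + 1)‖ ≤ u n := by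
  obtain ⟨C, hC⟩ := exists_nat_ge ‖c‖
  set q := Real.exp (-(2 * Real.pi * a.im)) with hq
  have hq0 : 0 < q := Real.exp_pos _
  have hq1 : q < 1 := Real.exp_lt_one_iff.2 (neg_lt_zero.2 (by positivity))
  refine ⟨fun n => q ^ (n + 1) * (((n + (1 + C) : ℕ) : ℝ) ^ k * Real.exp (Real.pi * k)), ?_,
    fun n s hs => ?_⟩
  · have h1 := (summable_nat_add_iff (1 + C)).2 (summable_pow_mul_geometric_of_norm_lt_one k
      (r := q) (by rwa [Real.norm_of_nonneg hq0.le]))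
    refine (h1.mul_right ((q ^ C)⁻¹ * Real.exp (Real.pi * k))).congr fun n => ?_
    rw [← add_assoc n 1 C, pow_add q (n + 1) C]
    field_simp
  · have hre : 1 ≤ ((((n + 1 : ℕ) : ℂ)) + c).re := by
      rw [add_re, natCast_re]
      push_cast
      linarith [(Nat.cast_nonneg n : (0 : ℝ) ≤ n)]
    have hz1 : 1 ≤ ‖((n + 1 : ℕ) : ℂ) + c‖ := hre.trans (re_le_norm _)
    have hz2 : ‖((n + 1 : ℕ) : ℂ) + c‖ ≤ ((n + (1 + C) : ℕ) : ℝ) := by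
      refine (norm_add_le _ _).trans ?_
      rw [norm_natCast]
      push_cast
      linarith
    rw [lerchTerm, norm_mul, norm_exp_two_pi_I_mul]
    refine mul_le_mul_of_nonneg_left
      ((norm_cpow_neg_le hz1 (by simpa using (mem_ball_zero_iff.1 hs).le)).trans ?_) (by positivity)
    gcongr

theorem natCast_add_ne_zero {c : ℂ} (hc : 0 < c.re) (n : ℕ) : (n : ℂ) + c ≠ 0 := by
  intro h
  have h1 := congrArg Complex.re h
  rw [add_re, natCast_re, zero_re] at h1
  linarith [(Nat.cast_nonneg n : (0 : ℝ) ≤ n)]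

theorem differentiable_lerchTerm {a c : ℂ} (hc : 0 < c.re) (n : ℕ) :
    Differentiable ℂ fun s => lerchTerm s a c n := fun s =>
  (DifferentiableAt.const_cpow (by fun_prop) (Or.inl (natCast_add_ne_zero hc n))).const_mul _

theorem summable_lerchTerm {a c : ℂ} (ha : 0 < a.im) (hc : 0 < c.re) (s : ℂ) :
    Summable (lerchTerm s a c) := by
  obtain ⟨k, hk⟩ := exists_nat_gt ‖s‖
  obtain ⟨u, hu, hb⟩ := exists_summable_bound_lerchTerm ha hc k
  exact (summable_nat_add_iff 1).1
    (hu.of_norm_bounded fun n => hb n s (mem_ball_zero_iff.2 hk))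

theorem differentiable_tsum_lerchTerm {a c : ℂ} (ha : 0 < a.im) (hc : 0 < c.re) :
    Differentiable ℂ fun s => ∑' n, lerchTerm s a c n := by
  intro s
  simp only [(summable_lerchTerm ha hc _).tsum_eq_zero_add]
  obtain ⟨k, hk⟩ := exists_nat_gt ‖s‖
  obtain ⟨u, hu, hb⟩ := exists_summable_bound_lerchTerm ha hc k
  exact (differentiable_lerchTerm hc 0 s).add
    ((differentiableOn_tsum_of_summable_norm hu
      (fun n => (differentiable_lerchTerm hc (n + 1)).differentiableOn) isOpen_ball
      hb).differentiableAt (isOpen_ball.mem_nhds (mem_ball_zero_iff.2 hk)))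

theorem hasSum_lerchTerm_lerchZetaExt {s a c : ℂ} (h : (s, a, c) ∈ extendedPolycylinder)
    (h' : 0 < a.im ∨ (a.im = 0 ∧ 1 < s.re)) :
    HasSum (lerchTerm s a c) (lerchZetaExt s a c) := by
  by_cases hs : 0 < s.re
  · rw [lerchZetaExt_eq_lerchZeta hs]
    exact hasSum_lerchTerm_lerchZeta ⟨hs, h⟩ h'
  have ha : 0 < a.im := h'.resolve_right fun h1 => hs (by linarith [h1.2])
  have hc : 0 < c.re := h.2.1
  -- For fixed `a, c` both sides are entire in `s` and agree for real `s > 0`.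
  have key : EqOn (fun s => ∑' n, lerchTerm s a c n) (fun s => lerchZetaExt s a c) univ := by
    refine eqOn_of_eventually_eq_ofReal isOpen_univ isPreconnected_univ
      (differentiable_tsum_lerchTerm ha hc).differentiableOn ?_ (x₀ := 1) (mem_univ _) ?_
    · exact differentiableOn_lerchZetaExt.comp (f := fun s : ℂ => (s, a, c)) (by fun_prop)
        fun s _ => h
    · filter_upwards [eventually_gt_nhds one_pos] with x hx
      have hx' : 0 < (x : ℂ).re := by simpa using hx
      rw [lerchZetaExt_eq_lerchZeta hx']
      exact (hasSum_lerchTerm_lerchZeta ⟨hx', h⟩ (Or.inl ha)).tsum_eq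
  rw [← show _ = lerchZetaExt s a c from key (mem_univ s)]
  exact (summable_lerchTerm ha hc s).hasSum

end

/-! ### Assembly -/

theorem mainTheorem4 :
    -- (1) on the fundamental polycylinder; the integral defining `ζ` converges absolutely
    ((∀ s a c : ℂ, (s, a, c) ∈ fundamentalPolycylinder →
        MeasureTheory.IntegrableOn (lerchIntegrand s a c) (Set.Ioi (0 : ℝ))) ∧
      HolomorphicOn3 (lerchLHatPlus lerchZeta) fundamentalPolycylinder ∧
      (∀ s a c : ℂ, (s, a, c) ∈ fundamentalPolycylinder →
        lerchLHatPlus lerchZeta s a c =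
          exp (-2 * Real.pi * I * a * c) * lerchLHatPlus lerchZeta (1 - s) (1 - c) a) ∧
      HolomorphicOn3 (lerchLHatMinus lerchZeta) fundamentalPolycylinder ∧
      (∀ s a c : ℂ, (s, a, c) ∈ fundamentalPolycylinder →
        lerchLHatMinus lerchZeta s a c =
          I * exp (-2 * Real.pi * I * a * c) * lerchLHatMinus lerchZeta (1 - s) (1 - c) a)) ∧
    -- (2) on the extended polycylinder
    ∃ Z HPlus HMinus : ℂ → ℂ → ℂ → ℂ,
      -- `ζ` continues holomorphically, and the continuation is the sum of the Lerch series
      -- where that series converges absolutely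
      IsContinuationToExtended lerchZeta Z ∧
      (∀ s a c : ℂ, (s, a, c) ∈ extendedPolycylinder →
        (0 < a.im ∨ (a.im = 0 ∧ 1 < s.re)) → HasSum (lerchTerm s a c) (Z s a c)) ∧
      -- `L⁺` and `L⁻` continue holomorphically
      IsContinuationToExtended (lerchLPlus lerchZeta) (lerchLPlus Z) ∧
      IsContinuationToExtended (lerchLMinus lerchZeta) (lerchLMinus Z) ∧
      -- the completed functions continue holomorphically, also across the poles of the Gamma
      -- factors, and the continuations satisfy the functional equations everywhere
      IsContinuationToExtended (lerchLHatPlus lerchZeta) HPlus ∧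
      (∀ s a c : ℂ, (s, a, c) ∈ extendedPolycylinder → (∀ n : ℕ, s ≠ -(2 * (n : ℂ))) →
        HPlus s a c = lerchLHatPlus Z s a c) ∧
      (∀ s a c : ℂ, (s, a, c) ∈ extendedPolycylinder →
        HPlus s a c = exp (-2 * Real.pi * I * a * c) * HPlus (1 - s) (1 - c) a) ∧
      IsContinuationToExtended (lerchLHatMinus lerchZeta) HMinus ∧
      (∀ s a c : ℂ, (s, a, c) ∈ extendedPolycylinder → (∀ n : ℕ, s ≠ -(2 * (n : ℂ) + 1)) →
        HMinus s a c = lerchLHatMinus Z s a c) ∧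
      (∀ s a c : ℂ, (s, a, c) ∈ extendedPolycylinder →
        HMinus s a c = I * exp (-2 * Real.pi * I * a * c) * HMinus (1 - s) (1 - c) a) := by
  have hsub := fundamentalPolycylinder_subset
  have hpos {s a c : ℂ} (h : (s, a, c) ∈ fundamentalPolycylinder) : 0 < s.re := h.1.1
  refine ⟨⟨fun s a c h => integrableOn_lerchIntegrand (hsub h),
    differentiableOn_lerchLHatPlus.mono hsub, fun s a c h => ?_,
    differentiableOn_lerchLHatMinus.mono hsub,
    fun s a c h => lerchLHatMinus_functional_equation h⟩,
    lerchZetaExt, lerchHPlus, lerchHMinus,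
    ⟨differentiableOn_lerchZetaExt, fun s a c h => lerchZetaExt_eq_lerchZeta (hpos h) a c⟩,
    fun s a c => hasSum_lerchTerm_lerchZetaExt, ⟨?_, fun s a c h => ?_⟩, ⟨?_, fun s a c h => ?_⟩,
    ⟨differentiableOn_lerchHPlus, fun s a c h => reflectExtend_of_pos (hpos h) a c⟩,
    fun s a c h hs => ?_, fun s a c h => ?_,
    ⟨differentiableOn_lerchHMinus, fun s a c h => reflectExtend_of_pos (hpos h) a c⟩,
    fun s a c h hs => ?_, fun s a c h => ?_⟩
  · simpa only [one_mul] using lerchLHatPlus_functional_equation h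
  · unfold HolomorphicOn3
    simp only [lerchLPlus_lerchZetaExt]
    exact differentiableOn_inv_Gammaℝ_mul_lerchHPlus
  · simp only [lerchLPlus, lerchZetaExt_eq_lerchZeta (hpos h)]
  · unfold HolomorphicOn3
    simp only [lerchLMinus_lerchZetaExt]
    exact differentiableOn_inv_Gammaℝ_mul_lerchHMinus
  · simp only [lerchLMinus, lerchZetaExt_eq_lerchZeta (hpos h)]
  -- `Gammaℝ` takes the default value 0 exactly at its poles, which `hs` excludes.
  · have hG : Gammaℝ s ≠ 0 := by
      rw [Ne, Gammaℝ_eq_zero_iff]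
      exact fun ⟨n, hn⟩ => hs n hn
    rw [lerchLHatPlus_eq_Gammaℝ_mul, lerchLPlus_lerchZetaExt, mul_inv_cancel_left₀ hG]
  · simpa only [one_mul, lerchHPlus] using reflectExtend_functional_equation (one_pow 4)
      (fun _ _ _ => lerchLHatPlus_functional_equation) (lerchLHatPlus_one_sub _) h
  · have hG : Gammaℝ (s + 1) ≠ 0 := by
      rw [Ne, Gammaℝ_eq_zero_iff]
      rintro ⟨n, hn⟩
      exact hs n (by linear_combination hn)
    rw [lerchLHatMinus_eq_Gammaℝ_mul, lerchLMinus_lerchZetaExt, mul_inv_cancel_left₀ hG]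
  · exact reflectExtend_functional_equation I_pow_four
      (fun _ _ _ => lerchLHatMinus_functional_equation) (lerchLHatMinus_one_sub _) h
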